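/- **Theorem (existence and uniqueness of a discrete solution).** Let $d\in\{2,3\}$ and let $\Omega\subset\mathbb{R}^d$ be a bounded connected open polyhedral domain with Lipschitz boundary $\Gamma$. Let $f\in L^2(\Omega;\mathbb{R}^d)$. Write $\tau:\eta=\sum_{i,j}\tau_{ij}\eta_{ij}$ and $|\tau|^2=\tau:\tau$ for matrices. *Stress-strain law.* Let $\sigma:\Omega\times\mathbb{R}^{d\times d}_{\rm sym}\to\mathbb{R}^{d\times d}_{\rm sym}$ be such that $\sigma(x,\cdot)$ is continuous for a.e. $x\in\Omega$, $\sigma(\cdot,\tau)$ is measurable for all $\tau$, $\sigma(\cdot,0)\in L^2(\Omega;\mathbb{R}^{d\times d})$, and there are real numbers $\overline\sigma,\underline\sigma>0$ such that, for a.e. $x\in\Omega$ and all symmetric $\tau,\eta$, $$|\sigma(x,\tau)-\sigma(x,0)|\le\overline\sigma|\tau|,\qquad \sigma(x,\tau):\tau\ge\underline\sigma|\tau|^2,\qquad (\sigma(x,\tau)-\sigma(x,\eta)):(\tau-\eta)\ge0 .$$ *Meshes.* A mesh $\mathcal{T}_h$ of $\Omega$ is a finite collection of nonempty, pairwise disjoint,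 open polyhedral elements $T$ with $\overline\Omega=\bigcup_T\overline T$, together with a finite set $\mathcal{F}_h$ of faces. A face is a closed connected subset of $\overline\Omega$ that lies in a hyperplane and has positive $(d-1)$-dimensional measure; it is contained either in $\partial T_1\cap\partial T_2$ for distinct elements $T_1,T_2$ (interface) or in $\partial T\cap\Gamma$ for an element $T$ (boundary face). Distinct faces overlap only in sets of zero $(d-1)$-dimensional measure. With $\mathcal{F}_T=\{F\in\mathcal{F}_h: F\subset\partial T\}$, one has $\partial T=\bigcup_{F\in\mathcal{F}_T}F$, and each $F\in\mathcal{F}_T$ has a unit normal $n_{TF}$ pointing out of $T$. Let $h_X$ denote the diameter of $X$. Let $(\mathcal{T}_h)_{h\in\mathcal{H}}$ be a regular mesh sequence: $\mathcal{H}\subset(0,\infty)$ is countable with $0$ as its unique accumulation point, $h=\max_{T\in\mathcal{T}_h}h_T$, and there is $\varrho>0$ such that every $\mathcal{T}_h$ has a matching simplicial submesh, each of whose simplices $S$ has inradius at least $\varrho h_S$ and satisfies $\varrho h_T\le h_S$ whenever $S\subset\overline T$, $T\in\mathcal{T}_h$. *Discrete problem.* Let $k\ge1$ be an integer and $\gamma>0$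 a real number independent of $h$. Let $P^l(X;V)$ be the space of restrictions to $X$ of $V$-valued polynomials of total degree at most $l$ on $\mathbb{R}^d$, and $\pi^l_X$ the $L^2(X)$-orthogonal projection on $P^l(X;\mathbb{R}^d)$. Let $U_h=\prod_{T\in\mathcal{T}_h}P^k(T;\mathbb{R}^d)\times\prod_{F\in\mathcal{F}_h}P^k(F;\mathbb{R}^d)$ with generic element $v=((v_T)_T,(v_F)_F)$, let $U_{h,0}$ be its subspace where $v_F=0$ for all boundary faces $F$, and let $v_h$ be the broken polynomial equal to $v_T$ on each $T$. Denote by $\nabla_{\rm s}$ and $\nabla_{\rm ss}$ the symmetric and skew-symmetric parts of the gradient, with $(\nabla v)_{ij}=\partial_i v_j$. For $v\in U_h$ and $T\in\mathcal{T}_h$ let $G_Tv\in P^k(T;\mathbb{R}^{d\times d}_{\rm sym})$ be such that $$\int_T G_Tv:\tau=\int_T\nabla_{\rm s}v_T:\tau+\sum_{F\in\mathcal{F}_T}\int_F(v_F-v_T)\cdot(\tau n_{TF})\qquad\forall\tau\in P^k(T;\mathbb{R}^{d\times d}_{\rm sym}),$$ and let $r_Tv\in P^{k+1}(T;\mathbb{R}^d)$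 be such that $\int_T(\nabla_{\rm s}r_Tv-G_Tv):\nabla_{\rm s}w=0$ for all $w\in P^{k+1}(T;\mathbb{R}^d)$, $\int_Tr_Tv=\int_Tv_T$, and $\int_T\nabla_{\rm ss}r_Tv=\sum_{F\in\mathcal{F}_T}\int_F\frac12(n_{TF}\otimes v_F-v_F\otimes n_{TF})$. Let $G_hv$ be equal to $G_Tv$ on each $T$, let $\Delta_{TF}v=\pi^k_F(r_Tv-v_F)-\pi^k_T(r_Tv-v_T)$ on each $F\in\mathcal{F}_T$, and set $$A_h(u,v)=\int_\Omega\sigma(\cdot,G_hu):G_hv,\qquad s_h(u,v)=\sum_{T\in\mathcal{T}_h}\sum_{F\in\mathcal{F}_T}\frac{\gamma}{h_F}\int_F\Delta_{TF}u\cdot\Delta_{TF}v .$$ The discrete problem is: find $u\in U_{h,0}$ such that $$A_h(u,v)+s_h(u,v)=\int_\Omega f\cdot v_h\qquad\forall v\in U_{h,0}.$$ *Conclusion.* For every $h\in\mathcal{H}$ the discrete problem has at least one solution. If, in addition, $\sigma$ is strictly monotone, i.e. for a.e. $x\in\Omega$ one has $(\sigma(x,\tau)-\sigma(x,\eta)):(\tau-\eta)>0$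 for all symmetric $\tau\ne\eta$, then the solution is unique. -/

import Mathlib

open MeasureTheory Set Filter Topology

noncomputable section

namespace HHO

/-- The Euclidean space of points and of vectors. -/
abbrev E (d : ℕ) := EuclideanSpace ℝ (Fin d)

/-- Real `d × d` matrices. -/
abbrev Mat (d : ℕ) := Matrix (Fin d) (Fin d) ℝ

/-! ### Geometry of the domain -/

/-- Affine hyperplanes. -/
def IsHyperplane {d : ℕ} (A : Set (E d)) : Prop :=
  ∃ a : E d, a ≠ 0 ∧ ∃ b : ℝ, A = {x | inner ℝ a x = b}

/-- Bounded open polyhedral sets, not assumed convex or connected: the boundary consists of pieces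
of finitely many hyperplanes, and there are no slits or punctures (the set is the interior of its
closure). Equivalently, interiors of finite unions of convex polytopes. -/
structure IsOpenPolyhedron {d : ℕ} (T : Set (E d)) : Prop where
  isOpen : IsOpen T
  isBounded : Bornology.IsBounded T
  interior_closure : interior (closure T) = T
  frontier_subset : ∃ 𝒜 : Set (Set (E d)),
    𝒜.Finite ∧ (∀ A ∈ 𝒜, IsHyperplane A) ∧ frontier T ⊆ ⋃₀ 𝒜

/-- Lipschitz boundary: near each boundary point, and for a suitable unit vector `n`, the set is
the part lying strictly above the graph (in direction `n`) of a Lipschitz function of the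
component orthogonal to `n`. -/
def HasLipschitzBoundary {d : ℕ} (Ω : Set (E d)) : Prop :=
  ∀ x ∈ frontier Ω, ∃ U ∈ 𝓝 x, ∃ n : E d, ‖n‖ = 1 ∧ ∃ (L : NNReal) (φ : E d → ℝ),
    LipschitzWith L φ ∧
      Ω ∩ U = {y ∈ U | φ (y - (inner ℝ n y : ℝ) • n) < inner ℝ n y}

/-- Bounded connected open polyhedral domains with Lipschitz boundary. -/
structure IsDomain {d : ℕ} (Ω : Set (E d)) : Prop where
  isOpenPolyhedron : IsOpenPolyhedron Ω
  isConnected : IsConnected Ω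
  lipschitz : HasLipschitzBoundary Ω

/-- The surface measure: the `(d-1)`-dimensional Hausdorff measure, normalised so that it agrees
with the Lebesgue measure on hyperplanes. -/
def surface (d : ℕ) : Measure (E d) := μHE[d - 1]

/-- `n` is a unit normal to the hyperplanar set `F`, pointing out of `T`: it is orthogonal to `F`,
and at almost every point of `F` one leaves `T` when crossing `F` in the direction `n`. -/
structure IsOutwardUnitNormal {d : ℕ} (T F : Set (E d)) (n : E d) : Prop where
  norm_eq : ‖n‖ = 1
  orthogonal : ∀ x ∈ F, ∀ y ∈ F, inner ℝ n (x - y) = 0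
  outward : ∀ᵐ x ∂((surface d).restrict F),
    ∀ᶠ t : ℝ in 𝓝[>] 0, x - t • n ∈ T ∧ x + t • n ∉ T

/-- A polytopal mesh of `Ω`: finitely many elements and finitely many faces. -/
structure PolytopalMesh {d : ℕ} (Ω : Set (E d)) where
  /-- the mesh elements `T` -/
  elements : Finset (Set (E d))
  /-- the mesh faces `F` -/
  faces : Finset (Set (E d))
  element_nonempty : ∀ T ∈ elements, T.Nonempty
  element_polyhedron : ∀ T ∈ elements, IsOpenPolyhedron T
  element_disjoint : ∀ T₁ ∈ elements, ∀ T₂ ∈ elements, T₁ ≠ T₂ → Disjoint T₁ T₂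
  closure_eq : closure Ω = ⋃ T ∈ elements, closure T
  face_closed : ∀ F ∈ faces, IsClosed F
  face_connected : ∀ F ∈ faces, IsConnected F
  face_hyperplanar : ∀ F ∈ faces, ∃ A, IsHyperplane A ∧ F ⊆ A
  face_subset : ∀ F ∈ faces, F ⊆ closure Ω
  face_pos : ∀ F ∈ faces, 0 < surface d F
  /-- every face is an interface or a boundary face -/
  face_cases : ∀ F ∈ faces,
    (∃ T₁ ∈ elements, ∃ T₂ ∈ elements, T₁ ≠ T₂ ∧ F ⊆ frontier T₁ ∩ frontier T₂) ∨
      ∃ T ∈ elements, F ⊆ frontier T ∩ frontier Ω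
  /-- distinct faces overlap only in a set of zero surface measure -/
  face_overlap : ∀ F₁ ∈ faces, ∀ F₂ ∈ faces, F₁ ≠ F₂ → surface d (F₁ ∩ F₂) = 0
  /-- the boundary of each element is the union of the faces that it contains; in particular the
  faces cover exactly the mesh skeleton -/
  frontier_eq : ∀ T ∈ elements, frontier T = ⋃₀ {F : Set (E d) | F ∈ faces ∧ F ⊆ frontier T}
  /-- each face of an element has a unit normal pointing out of that element -/
  exists_normal : ∀ T ∈ elements, ∀ F ∈ faces, F ⊆ frontier T →
    ∃ n, IsOutwardUnitNormal T F n

/-! ### Regular mesh sequences -/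

/-- The inradius of a set: the supremum of the radii of the closed balls that it contains. -/
def inradius {d : ℕ} (S : Set (E d)) : ℝ :=
  sSup {r : ℝ | 0 ≤ r ∧ ∃ x, Metric.closedBall x r ⊆ S}

/-- The full-dimensional closed simplices of a simplicial complex. -/
def simplices {d : ℕ} (K : Geometry.SimplicialComplex ℝ (E d)) : Set (Set (E d)) :=
  {S | ∃ s ∈ K.faces, s.card = d + 1 ∧ S = convexHull ℝ (s : Set (E d))}

/-- The simplicial complex `K` is a matching simplicial submesh of `𝓜`: it is finite, each of its
full-dimensional simplices lies in a mesh element, and each mesh element is filled by simplices.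
(Matching: two simplices of a complex meet in the hull of their common vertices.) -/
structure IsMatchingSubmesh {d : ℕ} {Ω : Set (E d)} (𝓜 : PolytopalMesh Ω)
    (K : Geometry.SimplicialComplex ℝ (E d)) : Prop where
  finite : K.faces.Finite
  subset_element : ∀ S ∈ simplices K, ∃ T ∈ 𝓜.elements, S ⊆ closure T
  element_eq : ∀ T ∈ 𝓜.elements, closure T = ⋃₀ {S | S ∈ simplices K ∧ S ⊆ closure T}

/-- Regular mesh sequences `(𝓣 h)`, indexed by a countable set `H` of meshsizes whose unique
accumulation point is `0`, with a common regularity parameter `ϱ`. -/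
structure IsRegularMeshSequence {d : ℕ} {Ω : Set (E d)} (H : Set ℝ)
    (𝓣 : H → PolytopalMesh Ω) : Prop where
  countable : H.Countable
  pos : ∀ h ∈ H, 0 < h
  accPt_iff : ∀ x : ℝ, AccPt x (𝓟 H) ↔ x = 0
  meshsize : ∀ h : H, IsGreatest {r | ∃ T ∈ (𝓣 h).elements, r = Metric.diam T} (h : ℝ)
  regular : ∃ ϱ : ℝ, 0 < ϱ ∧ ∀ h : H, ∃ K : Geometry.SimplicialComplex ℝ (E d),
    IsMatchingSubmesh (𝓣 h) K ∧
    (∀ S ∈ simplices K, ϱ * Metric.diam S ≤ inradius S) ∧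
    ∀ T ∈ (𝓣 h).elements, ∀ S ∈ simplices K, S ⊆ closure T →
      ϱ * Metric.diam T ≤ Metric.diam S

/-! ### Tensors and the stress-strain law -/

/-- The Frobenius product `τ : η`. -/
def frob {d : ℕ} (τ η : Mat d) : ℝ := ∑ i, ∑ j, τ i j * η i j

/-- The Frobenius norm. -/
def frobNorm {d : ℕ} (τ : Mat d) : ℝ := Real.sqrt (frob τ τ)

/-- Standing assumption on the stress-strain function `σ : Ω × ℝ^{d×d}_sym → ℝ^{d×d}_sym` (values
of `σ` at other arguments are irrelevant). -/
structure StressAssumption {d : ℕ} (Ω : Set (E d)) (σ : E d → Mat d → Mat d) : Prop where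
  symm : ∀ x ∈ Ω, ∀ τ : Mat d, τ.IsSymm → (σ x τ).IsSymm
  continuous : ∀ᵐ x ∂(volume.restrict Ω), ContinuousOn (σ x) {τ | τ.IsSymm}
  measurable : ∀ τ : Mat d, τ.IsSymm →
    ∀ i j, AEStronglyMeasurable (fun x => σ x τ i j) (volume.restrict Ω)
  memLp_zero : ∀ i j, MemLp (fun x => σ x 0 i j) 2 (volume.restrict Ω)
  bounds : ∃ σup > (0 : ℝ), ∃ σlow > (0 : ℝ), ∀ᵐ x ∂(volume.restrict Ω),
    ∀ τ : Mat d, τ.IsSymm → ∀ η : Mat d, η.IsSymm →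
      frobNorm (σ x τ - σ x 0) ≤ σup * frobNorm τ ∧
      σlow * frobNorm τ ^ 2 ≤ frob (σ x τ) τ ∧
      0 ≤ frob (σ x τ - σ x η) (τ - η)

/-- Strict monotonicity of the stress-strain function. -/
def StrictlyMonotoneStress {d : ℕ} (Ω : Set (E d)) (σ : E d → Mat d → Mat d) : Prop :=
  ∀ᵐ x ∂(volume.restrict Ω), ∀ τ : Mat d, τ.IsSymm → ∀ η : Mat d, η.IsSymm → τ ≠ η →
    0 < frob (σ x τ - σ x η) (τ - η)

/-! ### Polynomial spaces and differential operators -/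

/-- The real polynomial functions on `ℝ^d` of total degree at most `l`. -/
def scalarPoly (d l : ℕ) : Submodule ℝ (E d → ℝ) :=
  (MvPolynomial.restrictTotalDegree (Fin d) ℝ l).map
    (LinearMap.pi fun x : E d => (MvPolynomial.aeval fun i => x i).toLinearMap)

/-- The vector-valued polynomial functions of degree at most `l`. For a nonempty open set `T` this
is `P^l(T; ℝ^d)`: a polynomial is determined by its restriction to `T`. -/
def vecPoly (d l : ℕ) : Submodule ℝ (E d → E d) where
  carrier := {v | ∀ i, (fun x => v x i) ∈ scalarPoly d l}
  add_mem' ha hb i := (scalarPoly d l).add_mem (ha i) (hb i)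
  zero_mem' _ := (scalarPoly d l).zero_mem
  smul_mem' c _ ha i := (scalarPoly d l).smul_mem c (ha i)

/-- The polynomial functions of degree at most `l` with symmetric matrix values, that is
`P^l(T; ℝ^{d×d}_sym)` for a nonempty open set `T`. -/
def symPoly (d l : ℕ) : Submodule ℝ (E d → Mat d) where
  carrier := {τ | (∀ i j, (fun x => τ x i j) ∈ scalarPoly d l) ∧ ∀ x, (τ x).IsSymm}
  add_mem' ha hb := ⟨fun i j => (scalarPoly d l).add_mem (ha.1 i j) (hb.1 i j),
    fun x => (ha.2 x).add (hb.2 x)⟩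
  zero_mem' := ⟨fun _ _ => (scalarPoly d l).zero_mem, fun _ => Matrix.isSymm_zero⟩
  smul_mem' c _ ha := ⟨fun i j => (scalarPoly d l).smul_mem c (ha.1 i j),
    fun x => (ha.2 x).smul c⟩

/-- `P^l(F; ℝ^d)`: the restrictions to `F` of vector-valued polynomials of degree at most `l`. -/
def facePoly {d : ℕ} (l : ℕ) (F : Set (E d)) : Submodule ℝ (F → E d) :=
  (vecPoly d l).map (LinearMap.funLeft ℝ (E d) (Subtype.val : F → E d))

/-- The gradient, with entries `(∇v)_{ij} = ∂_i v_j`. -/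
def grad {d : ℕ} (v : E d → E d) (x : E d) : Mat d :=
  Matrix.of fun i j => fderiv ℝ (fun y => v y j) x (EuclideanSpace.single i 1)

/-- The symmetric gradient. -/
def symGrad {d : ℕ} (v : E d → E d) (x : E d) : Mat d :=
  (1 / 2 : ℝ) • (grad v x + (grad v x).transpose)

/-- The skew-symmetric part of the gradient. -/
def skewGrad {d : ℕ} (v : E d → E d) (x : E d) : Mat d :=
  (1 / 2 : ℝ) • (grad v x - (grad v x).transpose)

/-- The `L²(μ)`-orthogonal projection of `w` on the space `P`: the element `p` of `P` such that
`∫ (p - w) · q = 0` for all `q` in `P`. -/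
def l2Proj {d : ℕ} {α : Type*} [MeasurableSpace α] (μ : Measure α)
    (P : Submodule ℝ (α → E d)) (w : α → E d) : α → E d :=
  Classical.epsilon fun p => p ∈ P ∧ ∀ q ∈ P, ∫ x, (inner ℝ (p x - w x) (q x) : ℝ) ∂μ = 0

/-- The surface measure on a face, as a measure on the subtype `F`. -/
def faceMeasure {d : ℕ} (F : Set (E d)) : Measure F :=
  (surface d).comap Subtype.val

/-! ### The Hybrid High-Order method -/

variable {d : ℕ} {Ω : Set (E d)}

/-- The space `U_h` of degrees of freedom: a polynomial of degree at most `k` on each element and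
on each face. -/
abbrev Dofs (𝓜 : PolytopalMesh Ω) (k : ℕ) : Type :=
  ({T // T ∈ 𝓜.elements} → vecPoly d k) × ((F : {F // F ∈ 𝓜.faces}) → facePoly k F.1)

/-- The component `v_T` of a collection of degrees of freedom. -/
def Dofs.elem {𝓜 : PolytopalMesh Ω} {k : ℕ} (v : Dofs 𝓜 k) (T : {T // T ∈ 𝓜.elements}) :
    E d → E d := (v.1 T).1

/-- The component `v_F` of a collection of degrees of freedom. -/
def Dofs.face {𝓜 : PolytopalMesh Ω} {k : ℕ} (v : Dofs 𝓜 k) (F : {F // F ∈ 𝓜.faces}) :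
    F.1 → E d := (v.2 F).1

/-- The subspace `U_{h,0}`: the components on the boundary faces vanish. -/
def Dofs0 (𝓜 : PolytopalMesh Ω) (k : ℕ) : Submodule ℝ (Dofs 𝓜 k) where
  carrier := {v | ∀ F : {F // F ∈ 𝓜.faces},
    (∃ T ∈ 𝓜.elements, F.1 ⊆ frontier T ∩ frontier Ω) → v.2 F = 0}
  add_mem' ha hb F hF := by simp [ha F hF, hb F hF]
  zero_mem' _ _ := rfl
  smul_mem' c _ ha F hF := by simp [ha F hF]

open Classical in
/-- The faces contained in the boundary of `T`. -/
def facesOf (𝓜 : PolytopalMesh Ω) (T : {T // T ∈ 𝓜.elements}) : Finset {F // F ∈ 𝓜.faces} :=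
  Finset.univ.filter fun F => F.1 ⊆ frontier T.1

/-- The unit normal `n_{TF}` to the face `F` pointing out of the element `T`. -/
def normal (T F : Set (E d)) : E d := Classical.epsilon (IsOutwardUnitNormal T F)

variable {𝓜 : PolytopalMesh Ω} {k : ℕ}

/-- The local symmetric gradient reconstruction: the `G ∈ P^k(T; ℝ^{d×d}_sym)` such that
`∫_T G : τ = ∫_T ∇ₛ v_T : τ + ∑_F ∫_F (v_F - v_T) · (τ n_{TF})` for all `τ` in that space. -/
def symGradRec (v : Dofs 𝓜 k) (T : {T // T ∈ 𝓜.elements}) : E d → Mat d :=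
  Classical.epsilon fun G => G ∈ symPoly d k ∧ ∀ τ ∈ symPoly d k,
    ∫ x in T.1, frob (G x) (τ x) =
      (∫ x in T.1, frob (symGrad (v.elem T) x) (τ x)) +
      ∑ F ∈ facesOf 𝓜 T, (∫ x : F.1, (∑ i, (v.face F x i - v.elem T x i) *
        (τ x).mulVec (fun j => normal T.1 F.1 j) i) ∂(faceMeasure F.1))

/-- The local displacement reconstruction: the `r ∈ P^{k+1}(T; ℝ^d)` whose symmetric gradient is
the orthogonal projection of the reconstructed symmetric gradient, with prescribed mean value and
prescribed mean value of the skew-symmetric part of the gradient. -/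
def dispRec (v : Dofs 𝓜 k) (T : {T // T ∈ 𝓜.elements}) : E d → E d :=
  Classical.epsilon fun r => r ∈ vecPoly d (k + 1) ∧
    (∀ w ∈ vecPoly d (k + 1),
      ∫ x in T.1, frob (symGrad r x - symGradRec v T x) (symGrad w x) = 0) ∧
    (∀ i, ∫ x in T.1, r x i = ∫ x in T.1, v.elem T x i) ∧
    ∀ i j, ∫ x in T.1, skewGrad r x i j =
      ∑ F ∈ facesOf 𝓜 T, (∫ x : F.1, (1 / 2 : ℝ) *
        (normal T.1 F.1 i * v.face F x j - v.face F x i * normal T.1 F.1 j) ∂(faceMeasure F.1))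

/-- The face-based residual
`Δ_{TF} v = π_F (r_T v - v_F) - π_T (r_T v - v_T)`, as a function on `F`. -/
def residual (v : Dofs 𝓜 k) (T : {T // T ∈ 𝓜.elements}) (F : {F // F ∈ 𝓜.faces}) : F.1 → E d :=
  fun x =>
    l2Proj (faceMeasure F.1) (facePoly k F.1) (fun y => dispRec v T y - v.face F y) x -
    l2Proj (volume.restrict T.1) (vecPoly d k) (fun y => dispRec v T y - v.elem T y) x

/-- The local stabilisation bilinear form `s_T`, with scaling parameter `γ`. -/
def stabLocal (γ : ℝ) (T : {T // T ∈ 𝓜.elements}) (u v : Dofs 𝓜 k) : ℝ :=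
  ∑ F ∈ facesOf 𝓜 T, γ / Metric.diam F.1 *
    (∫ x : F.1, (inner ℝ (residual u T F x) (residual v T F x) : ℝ) ∂(faceMeasure F.1))

/-- The stabilisation bilinear form `s_h`. -/
def stab (γ : ℝ) (u v : Dofs 𝓜 k) : ℝ :=
  ∑ T : {T // T ∈ 𝓜.elements}, stabLocal γ T u v

/-- The broken polynomial function `v_h` equal to `v_T` on each element `T`. -/
def broken (v : Dofs 𝓜 k) (x : E d) : E d :=
  ∑ T : {T // T ∈ 𝓜.elements}, T.1.indicator (v.elem T) x

/-- The global symmetric gradient reconstruction, equal to the local one on each element. -/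
def globalSymGradRec (v : Dofs 𝓜 k) (x : E d) : Mat d :=
  ∑ T : {T // T ∈ 𝓜.elements}, T.1.indicator (symGradRec v T) x

/-- The consistency contribution `A_h`. -/
def consistency (σ : E d → Mat d → Mat d) (u v : Dofs 𝓜 k) : ℝ :=
  ∫ x in Ω, frob (σ x (globalSymGradRec u x)) (globalSymGradRec v x)

/-- `u ∈ U_{h,0}` solves the discrete problem: `A_h(u, v) + s_h(u, v) = ∫_Ω f · v_h` for all
`v ∈ U_{h,0}`. -/
def IsDiscreteSolution (σ : E d → Mat d → Mat d) (γ : ℝ) (f : E d → E d) (u : Dofs 𝓜 k) : Prop :=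
  u ∈ Dofs0 𝓜 k ∧ ∀ v ∈ Dofs0 𝓜 k,
    consistency σ u v + stab γ u v = ∫ x in Ω, (inner ℝ (f x) (broken v x) : ℝ)

end HHO

end

noncomputable section

namespace HHO

/-! ### Monotone operators and bilinear forms in finite dimension. -/

section

/-! For a fixed mesh this is Minty's theorem on the finite-dimensional space U_{h,0}. The map u ↦
A_h(u,·) + s_h(u,·) is monotone, because σ is monotone pointwise and s_h is positive semidefinite.
It is continuous along lines by dominated convergence (`StressAssumption.tendsto_integral`). It
satisfies a(u)(u) ≥ min(σlow, 1) (∫ G_h u : G_h u + s_h(u,u)). Minty's theorem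
(`exists_forall_eq_of_monotone`) is derived from Hahn–Banach separation and compactness, without
Brouwer's theorem.

What remains is that ∫ G_h v : G_h v + s_h(v,v) is positive definite on U_{h,0}, a Korn inequality
without constants (`eq_zero_of_symGradRec_of_stab`). If it vanishes, then G_T v = 0, hence r_T v has
zero symmetric gradient and is a rigid motion. Rigid motions are affine and k ≥ 1, so the
projections in the residual act as identities and Δ_{TF} v = v_T - v_F. Thus v_F = v_T on faces, the
face terms in the definition of G_T v drop out, and v_T is itself a rigid motion. A rigid motion
that vanishes on a face vanishes on its hyperplane, and then everywhere. Zero therefore spreads from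
the boundary faces through the interfaces to all elements.

The spreading (`PolytopalMesh.forall_of_propagate`) needs no adjacency graph of the mesh. A generic
ray from a supposedly bad element has a last point in the closed union of bad elements. That point
lies on a face of a bad element; the face cannot be a boundary face, so it separates two elements,
both bad. Close to the point each of them fills a half ball. Neither can fill the one ahead, so both
fill the one behind, which contradicts disjointness.

Uniqueness uses the same definiteness: testing the difference of two solutions with itself makes
both nonnegative terms vanish, and strict monotonicity turns the first into G_h u = G_h v.

The reconstructions and projections are chosen by `Classical.epsilon`; well-posedness of their
defining problems makes them linear in v. Definiteness of L² products on polynomials, over elements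
and over faces, comes from zero sets of analytic functions being null (`measure_zeros_eq_zero`). -/

/-- Debrunner-Flor: a finite monotone set of pairs is compatible with some point of a given compact
convex set containing the base points. -/
theorem exists_mem_forall_nonneg_of_monotone {V ι : Type*} [NormedAddCommGroup V]
    [NormedSpace ℝ V] [FiniteDimensional ℝ V] [Fintype ι] {K : Set V} (hK : Convex ℝ K)
    (hKc : IsCompact K) (z : ι → V) (hz : ∀ i, z i ∈ K) (hne : K.Nonempty)
    (y : ι → V →ₗ[ℝ] ℝ) (hmono : ∀ i j, 0 ≤ (y i - y j) (z i - z j)) :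
    ∃ x ∈ K, ∀ i, 0 ≤ y i (z i - x) := by
  classical
  by_contra hcon
  -- A point as required exists iff the convex compact set `g '' K` meets the nonnegative orthant.
  -- Otherwise a functional separates them strictly; its coefficients `lam` are nonnegative weights,
  -- and the weighted mean of the `z i` violates the separation.
  let g : V → ι → ℝ := fun x i => y i (z i - x)
  have hg : Continuous g := continuous_pi fun i =>
    ((y i).continuous_of_finiteDimensional).comp (continuous_const.sub continuous_id)
  have hcv : Convex ℝ (g '' K) := by
    rintro _ ⟨x, hx, rfl⟩ _ ⟨x', hx', rfl⟩ a b ha hb hab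
    refine ⟨a • x + b • x', hK hx hx' ha hb hab, ?_⟩
    funext i
    have : z i = a • z i + b • z i := by rw [← add_smul, hab, one_smul]
    simp only [g, Pi.add_apply, Pi.smul_apply, smul_eq_mul, map_sub, map_add, map_smul]
    conv_lhs => rw [this]
    simp only [map_add, map_smul, smul_eq_mul]
    ring
  have hdisj : Disjoint (g '' K) {c : ι → ℝ | ∀ i, 0 ≤ c i} := by
    rw [Set.disjoint_left]
    rintro _ ⟨x, hx, rfl⟩ h
    exact hcon ⟨x, hx, h⟩
  have horth : Convex ℝ {c : ι → ℝ | ∀ i, 0 ≤ c i} := by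
    intro c hc c' hc' a b ha hb _ i
    have h1 := hc i
    have h2 := hc' i
    simp only [Pi.add_apply, Pi.smul_apply, smul_eq_mul]
    positivity
  have horthc : IsClosed {c : ι → ℝ | ∀ i, 0 ≤ c i} := by
    simp only [ofPred_forall]
    exact isClosed_iInter fun i => isClosed_le continuous_const (continuous_apply i)
  obtain ⟨φ, s, t, h1, hst, h2⟩ :=
    geometric_hahn_banach_compact_closed hcv (hKc.image hg) horth horthc hdisj
  have ht : t < 0 := by simpa using h2 0 (fun i => le_rfl)
  let lam : ι → ℝ := fun i => φ (Pi.single i 1)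
  have hφ : ∀ c : ι → ℝ, φ c = ∑ i, lam i * c i := by
    intro c
    conv_lhs => rw [← Finset.univ_sum_single c]
    rw [map_sum]
    refine Finset.sum_congr rfl fun i _ => ?_
    have : Pi.single i (c i) = c i • (Pi.single i 1 : ι → ℝ) := by
      rw [← Pi.single_smul, smul_eq_mul, mul_one]
    rw [this, map_smul, smul_eq_mul, mul_comm]
  have hlam : ∀ i, 0 ≤ lam i := by
    intro i
    by_contra! hi
    -- As `t` and `lam i` are both negative, this vector lies in the orthant, and `φ` takes exactly
    -- the value `t` there.
    have := h2 ((t / lam i) • Pi.single i 1) (by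
      intro j
      have : 0 ≤ t / lam i := (div_pos_of_neg_of_neg ht hi).le
      simp only [Pi.smul_apply, smul_eq_mul]
      refine mul_nonneg this ?_
      by_cases h : j = i
      · subst h; simp
      · simp [h])
    rw [map_smul, smul_eq_mul] at this
    change t < t / lam i * lam i at this
    rw [div_mul_cancel₀ _ hi.ne] at this
    exact lt_irrefl _ this
  have hsum : 0 < ∑ i, lam i := by
    refine lt_of_le_of_ne (Finset.sum_nonneg fun i _ => hlam i) fun h0 => ?_
    have h0' : ∀ i, lam i = 0 := fun i =>
      (Finset.sum_eq_zero_iff_of_nonneg fun i _ => hlam i).1 h0.symm i (Finset.mem_univ i)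
    obtain ⟨x, hx⟩ := hne
    have := h1 _ ⟨x, hx, rfl⟩
    rw [hφ] at this
    simp only [h0', zero_mul, Finset.sum_const_zero] at this
    linarith
  let x := Finset.univ.centerMass lam z
  have hx : x ∈ K := hK.centerMass_mem (fun i _ => hlam i) hsum fun i _ => hz i
  have hxs : (∑ i, lam i) • x = ∑ i, lam i • z i := by
    simp only [x, Finset.centerMass]
    rw [smul_smul, mul_inv_cancel₀ hsum.ne', one_smul]
  have hneg := h1 _ ⟨x, hx, rfl⟩
  rw [hφ] at hneg
  have key : (∑ i, lam i) * ∑ i, lam i * g x i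
      = ∑ i, ∑ j, lam i * lam j * (y i (z i - z j)) := by
    rw [Finset.mul_sum]
    refine Finset.sum_congr rfl fun i _ => ?_
    have : (∑ j, lam j) * y i (z i - x) = ∑ j, lam j * y i (z i - z j) := by
      rw [← smul_eq_mul, ← map_smul, smul_sub, hxs, Finset.sum_smul, ← Finset.sum_sub_distrib,
        map_sum]
      refine Finset.sum_congr rfl fun j _ => ?_
      rw [← smul_sub, map_smul, smul_eq_mul]
    simp only [g]
    rw [mul_left_comm, this, Finset.mul_sum]
    refine Finset.sum_congr rfl fun j _ => by ring
  -- Symmetrisation: exchanging `i` and `j` changes the sign of `z i - z j`, so only the difference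
  -- `y i - y j` survives, and monotonicity applies.
  have key2 : 2 * ∑ i, ∑ j, lam i * lam j * (y i (z i - z j))
      = ∑ i, ∑ j, lam i * lam j * ((y i - y j) (z i - z j)) := by
    rw [two_mul]
    nth_rewrite 2 [Finset.sum_comm]
    rw [← Finset.sum_add_distrib]
    refine Finset.sum_congr rfl fun i _ => ?_
    rw [← Finset.sum_add_distrib]
    refine Finset.sum_congr rfl fun j _ => ?_
    simp only [LinearMap.sub_apply, map_sub]
    ring
  have key3 : 0 ≤ ∑ i, ∑ j, lam i * lam j * ((y i - y j) (z i - z j)) :=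
    Finset.sum_nonneg fun i _ => Finset.sum_nonneg fun j _ =>
      mul_nonneg (mul_nonneg (hlam i) (hlam j)) (hmono i j)
  have : (∑ i, lam i) * ∑ i, lam i * g x i < 0 := mul_neg_of_pos_of_neg hsum (by linarith)
  linarith

/-- Minty's theorem in an inner product space of finite dimension. -/
theorem exists_forall_eq_of_monotone {V : Type*} [NormedAddCommGroup V] [InnerProductSpace ℝ V]
    [FiniteDimensional ℝ V] (a : V → V →ₗ[ℝ] ℝ)
    (hmono : ∀ u v, 0 ≤ (a u - a v) (u - v))
    (hcont : ∀ u w v, Tendsto (fun t : ℝ => a (u + t • w) v) (𝓝[>] 0) (𝓝 (a u v)))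
    {c : ℝ} (hc : 0 < c) (hcoer : ∀ u, c * ‖u‖ ^ 2 ≤ a u u) (l : V →ₗ[ℝ] ℝ) :
    ∃ u, ∀ v, a u v = l v := by
  classical
  have : ProperSpace V := FiniteDimensional.proper ℝ V
  let L := l.toContinuousLinearMap
  -- Any radius above `‖L‖ / c` works: coercivity then keeps the solution of the variational
  -- inequality off the sphere.
  set R : ℝ := ‖L‖ / c + 1 with hR
  have hRpos : 0 < R := by positivity
  let K : Set V := Metric.closedBall 0 R
  have hK : Convex ℝ K := convex_closedBall 0 R
  have hKc : IsCompact K := isCompact_closedBall 0 R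
  have h0K : (0 : V) ∈ K := Metric.mem_closedBall_self hRpos.le
  -- The finite case supplies the finite intersection property of these closed subsets of a compact
  -- ball.
  have hex : (K ∩ ⋂ z : K, {x | 0 ≤ (a z - l) (z - x)}).Nonempty := by
    refine hKc.inter_iInter_nonempty _ (fun z => ?_) (fun s => ?_)
    · exact isClosed_le continuous_const
        ((LinearMap.continuous_of_finiteDimensional _).comp (continuous_const.sub continuous_id))
    · obtain ⟨x, hx, h⟩ := exists_mem_forall_nonneg_of_monotone hK hKc (fun z : s => (z : K).1)
        (fun z => z.1.2) ⟨0, h0K⟩ (fun z => a z.1 - l) (fun i j => by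
          have := hmono i.1.1 j.1.1
          simpa using this)
      refine ⟨x, hx, ?_⟩
      simp only [mem_iInter]
      exact fun i hi => h ⟨i, hi⟩
  obtain ⟨x, hxK, hx⟩ := hex
  simp only [mem_iInter, mem_ofPred_eq] at hx
  -- Minty's trick: the inequality known at `z = x + t • (w - x)` is divided by `t`, and `t → 0`
  -- moves the argument of `a` to `x`.
  have hVI : ∀ w ∈ K, 0 ≤ (a x - l) (w - x) := by
    intro w hw
    have hlim : Tendsto (fun t : ℝ => (a (x + t • (w - x)) - l) (w - x)) (𝓝[>] 0)
        (𝓝 ((a x - l) (w - x))) := by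
      simpa using (hcont x (w - x) (w - x)).sub_const (l (w - x))
    refine ge_of_tendsto hlim ?_
    filter_upwards [Ioo_mem_nhdsGT (zero_lt_one : (0 : ℝ) < 1)] with t ht
    have hmem : x + t • (w - x) ∈ K := by
      have := hK hxK hw (sub_nonneg.2 ht.2.le) ht.1.le (by ring)
      convert this using 1
      module
    have := hx ⟨_, hmem⟩
    rw [add_sub_cancel_left, map_smul, smul_eq_mul] at this
    exact nonneg_of_mul_nonneg_right this ht.1
  have hxlt : ‖x‖ < R := by
    have h1 := hVI 0 h0K
    simp only [zero_sub, map_neg, LinearMap.sub_apply] at h1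
    have h2 := hcoer x
    have h3 : l x ≤ ‖L‖ * ‖x‖ := (le_abs_self _).trans (L.le_opNorm x)
    by_contra! h
    have hxpos : 0 < ‖x‖ := hRpos.trans_le h
    have h4 : c * ‖x‖ * ‖x‖ ≤ ‖L‖ * ‖x‖ := by nlinarith
    have h5 : c * ‖x‖ ≤ ‖L‖ := le_of_mul_le_mul_right h4 hxpos
    have h6 : c * R = ‖L‖ + c := by rw [hR]; field_simp
    nlinarith
  -- Since `x` is interior to the ball, every direction is admissible; using `v` and `-v` yields the
  -- equation.
  have hhalf : ∀ v, 0 ≤ (a x - l) v := by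
    intro v
    have hnear : ∀ᶠ t : ℝ in 𝓝[>] 0, x + t • v ∈ K := by
      have : Tendsto (fun t : ℝ => x + t • v) (𝓝[>] 0) (𝓝 (x + (0 : ℝ) • v)) :=
        ((Continuous.tendsto (by fun_prop) 0).mono_left nhdsWithin_le_nhds)
      refine this.eventually (Metric.closedBall_mem_nhds_of_mem ?_)
      simpa using hxlt
    obtain ⟨t, htK, ht⟩ := (hnear.and self_mem_nhdsWithin).exists
    have := hVI _ htK
    rw [add_sub_cancel_left, map_smul, smul_eq_mul] at this
    exact nonneg_of_mul_nonneg_right this ht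
  refine ⟨x, fun v => ?_⟩
  have h1 := hhalf v
  have h2 := hhalf (-v)
  simp only [map_neg, LinearMap.sub_apply] at h1 h2
  linarith

/-- Minty's theorem, with coercivity measured by a positive definite symmetric bilinear form. -/
theorem exists_forall_eq_of_monotone_of_posDef {V : Type*} [AddCommGroup V] [Module ℝ V]
    [FiniteDimensional ℝ V] (B : V →ₗ[ℝ] V →ₗ[ℝ] ℝ) (hsymm : ∀ u v, B u v = B v u)
    (hpos : ∀ u, u ≠ 0 → 0 < B u u) (a : V → V →ₗ[ℝ] ℝ)
    (hmono : ∀ u v, 0 ≤ (a u - a v) (u - v))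
    (hcont : ∀ u w v, Tendsto (fun t : ℝ => a (u + t • w) v) (𝓝[>] 0) (𝓝 (a u v)))
    {c : ℝ} (hc : 0 < c) (hcoer : ∀ u, c * B u u ≤ a u u) (l : V →ₗ[ℝ] ℝ) :
    ∃ u, ∀ v, a u v = l v := by
  let C : InnerProductSpace.Core ℝ V :=
    { inner := fun u v => B u v
      conj_inner_symm := fun u v => by simpa using hsymm v u
      re_inner_nonneg := fun u => by
        by_cases h : u = 0
        · simp [h]
        · simpa using (hpos u h).le
      add_left := fun u v w => by simp
      smul_left := fun u v r => by simp
      definite := fun u h => by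
        by_contra hu
        exact (hpos u hu).ne' h }
  let _ : NormedAddCommGroup V := C.toNormedAddCommGroup
  let _ : InnerProductSpace ℝ V := InnerProductSpace.ofCore C.toCore
  refine exists_forall_eq_of_monotone a hmono hcont hc (fun u => ?_) l
  have : ‖u‖ ^ 2 = B u u := (real_inner_self_eq_norm_sq u).symm
  rw [this]
  exact hcoer u

/-- A positive definite bilinear form on a space of finite dimension represents each linear
functional. -/
theorem exists_forall_eq_of_posDef {V : Type*} [AddCommGroup V] [Module ℝ V]
    [FiniteDimensional ℝ V] (B : V →ₗ[ℝ] V →ₗ[ℝ] ℝ) (hpos : ∀ u, B u u = 0 → u = 0)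
    (l : V →ₗ[ℝ] ℝ) : ∃ u, ∀ v, B u v = l v := by
  have hinj : Function.Injective B := by
    rw [← LinearMap.ker_eq_bot, LinearMap.ker_eq_bot']
    intro u hu
    exact hpos u (by rw [hu]; rfl)
  have hsurj : Function.Surjective B :=
    (LinearMap.injective_iff_surjective_of_finrank_eq_finrank
      (Subspace.dual_finrank_eq (K := ℝ) (V := V)).symm).1 hinj
  obtain ⟨u, hu⟩ := hsurj l
  exact ⟨u, fun v => by rw [hu]⟩

/-- Identifies a value picked by `Classical.epsilon`, the form in which `l2Proj` is given. -/
theorem epsilon_eq_of_unique {P : Type*} [Nonempty P] {R : P → Prop} {p : P} (hp : R p)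
    (huniq : ∀ q q', R q → R q' → q = q') : Classical.epsilon R = p :=
  huniq _ _ (Classical.epsilon_spec ⟨p, hp⟩) hp

end

section

/-! ### Zeros of analytic functions and faces -/

/-- The zero set of a nonzero analytic function is a null set. -/
theorem measure_zeros_eq_zero {W : Type*} [NormedAddCommGroup W] [NormedSpace ℝ W]
    [FiniteDimensional ℝ W] [MeasurableSpace W] [BorelSpace W] (μ : Measure W)
    [μ.IsAddHaarMeasure] {g : W → ℝ} (hg : AnalyticOnNhd ℝ g univ) {x₀ : W} (h0 : g x₀ ≠ 0) :
    μ {x | g x = 0} = 0 := by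
  have hgc : Continuous g := continuousOn_univ.1 hg.continuousOn
  set Z : Set W := {y | g (x₀ + y) = 0} with hZ
  -- On each line through `x₀` the function is analytic in one variable and nonzero at `t = 0`, so
  -- its zeros are isolated.
  have hline : ∀ y : W, volume {t : ℝ | g (x₀ + t • y) = 0} = 0 := by
    intro y
    have hh : AnalyticOnNhd ℝ (fun t : ℝ => g (x₀ + t • y)) univ := by
      intro t _
      refine (hg _ (mem_univ _)).comp_of_eq (g := g) (f := fun t : ℝ => x₀ + t • y) ?_ rfl
      fun_prop
    have hcod := AnalyticOnNhd.preimage_zero_mem_codiscrete (x := (0 : ℝ)) hh (by simpa using h0)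
    have := ae_restrict_le_codiscreteWithin (μ := (volume : Measure ℝ)) MeasurableSet.univ hcod
    rw [Measure.restrict_univ, mem_ae_iff] at this
    simpa [preimage, compl_def] using this
  have hS : MeasurableSet {p : ℝ × W | g (x₀ + p.1 • p.2) = 0} :=
    (isClosed_eq (by fun_prop) continuous_const).measurableSet
  -- Fubini, read in both orders: slices at fixed `y` are null, hence so are almost all slices at
  -- fixed `t`. One such `t ≠ 0` suffices, since its slice is a dilate of `Z`.
  have h1 : (volume : Measure ℝ).prod μ {p : ℝ × W | g (x₀ + p.1 • p.2) = 0} = 0 := by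
    rw [← Measure.prod_swap, Measure.map_apply measurable_swap hS,
      Measure.measure_prod_null (measurable_swap hS)]
    exact Eventually.of_forall fun y => hline y
  have h2 := Measure.measure_ae_null_of_prod_null h1
  have h3 : ∀ᵐ t : ℝ, t ≠ 0 := by
    simp [ae_iff]
  obtain ⟨t, ht, ht0⟩ := (h2.and h3).exists
  change μ ((t • ·) ⁻¹' Z) = 0 at ht
  rw [Measure.addHaar_preimage_smul μ ht0] at ht
  have hZ0 : μ Z = 0 := by
    rcases mul_eq_zero.1 ht with h | h
    · rw [ENNReal.ofReal_eq_zero] at h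
      exact absurd h (not_le.2 (abs_pos.2 (inv_ne_zero (pow_ne_zero _ ht0))))
    · exact h
  have : Z = (fun y => x₀ + y) ⁻¹' {x | g x = 0} := rfl
  rwa [this, measure_preimage_add] at hZ0

theorem analytic_eq_zero_of_ae_of_pos {W : Type*} [NormedAddCommGroup W] [NormedSpace ℝ W]
    [FiniteDimensional ℝ W] [MeasurableSpace W] [BorelSpace W] (μ : Measure W)
    [μ.IsAddHaarMeasure] {g : W → ℝ} (hg : AnalyticOnNhd ℝ g univ) {s : Set W}
    (hs : μ s ≠ 0) (h : μ (s ∩ {x | g x ≠ 0}) = 0) (x : W) : g x = 0 := by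
  by_contra hx
  refine hs (measure_mono_null (t := s ∩ {x | g x ≠ 0} ∪ {x | g x = 0}) ?_
    (measure_union_null h (measure_zeros_eq_zero μ hg hx)))
  intro y hy
  by_cases hgy : g y = 0
  · exact Or.inr hgy
  · exact Or.inl ⟨hy, hgy⟩

/-- The isometric parametrisation of the hyperplane through `x₀` orthogonal to `a`. -/
def hyperplaneParam {d : ℕ} (a x₀ : E d) (w : (Submodule.span ℝ {a})ᗮ) : E d := x₀ + (w : E d)

theorem isometry_hyperplaneParam {d : ℕ} (a x₀ : E d) : Isometry (hyperplaneParam a x₀) := by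
  refine Isometry.of_dist_eq fun w w' => ?_
  simp only [hyperplaneParam, dist_add_left]
  rfl

theorem range_hyperplaneParam {d : ℕ} (a x₀ : E d) :
    range (hyperplaneParam a x₀) = {x | inner ℝ a x = inner ℝ a x₀} := by
  ext x
  constructor
  · rintro ⟨w, rfl⟩
    have := Submodule.mem_orthogonal_singleton_iff_inner_right.1 w.2
    simp [hyperplaneParam, inner_add_right, this]
  · intro hx
    refine ⟨⟨x - x₀, Submodule.mem_orthogonal_singleton_iff_inner_right.2 ?_⟩, ?_⟩
    · rw [inner_sub_right, sub_eq_zero]; exact hx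
    · simp [hyperplaneParam]

/-- Hausdorff measure is invariant under isometries, and its normalised form on the
(d-1)-dimensional orthogonal complement of `a` is Lebesgue measure. Faces thereby inherit finiteness
and the null zero sets of analytic functions. -/
theorem surface_eq_volume_preimage {d : ℕ} {a : E d} (ha : a ≠ 0) (x₀ : E d) {s : Set (E d)}
    (hs : s ⊆ {x | inner ℝ a x = inner ℝ a x₀}) :
    surface d s = volume (hyperplaneParam a x₀ ⁻¹' s) := by
  have hd : d ≠ 0 := by
    rintro rfl
    exact ha (Subsingleton.elim _ _)
  obtain ⟨m, rfl⟩ := Nat.exists_eq_succ_of_ne_zero hd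
  have : Fact (Module.finrank ℝ (E (m + 1)) = m + 1) := ⟨by simp⟩
  have hrank : Module.finrank ℝ (Submodule.span ℝ {a})ᗮ = m :=
    Submodule.finrank_orthogonal_span_singleton ha
  rw [← InnerProductSpace.euclideanHausdorffMeasure_eq_volume, hrank,
    (isometry_hyperplaneParam a x₀).euclideanHausdorffMeasure_preimage, range_hyperplaneParam,
    inter_eq_left.2 hs]
  rfl

theorem surface_lt_top {d : ℕ} {A F : Set (E d)} (hA : IsHyperplane A) (hF : F ⊆ A)
    (hb : Bornology.IsBounded F) : surface d F < ⊤ := by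
  obtain ⟨a, ha, b, rfl⟩ := hA
  rcases F.eq_empty_or_nonempty with rfl | ⟨x₀, hx₀⟩
  · simp
  have hx : inner ℝ a x₀ = b := hF hx₀
  subst hx
  rw [surface_eq_volume_preimage ha x₀ hF]
  exact ((isometry_hyperplaneParam a x₀).antilipschitz.isBounded_preimage hb).measure_lt_top

theorem faceMeasure_ae_iff {d : ℕ} {F : Set (E d)} (hF : MeasurableSet F) {p : E d → Prop} :
    (∀ᵐ x : F ∂(faceMeasure F), p x) ↔ surface d (F ∩ {x | ¬ p x}) = 0 := by
  have h : Subtype.val '' {x : F | ¬ p x} = F ∩ {x | ¬ p x} := by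
    ext x; simp [and_comm]
  rw [ae_iff, faceMeasure, (MeasurableEmbedding.subtype_coe hF).comap_apply]
  erw [h]

/-- An analytic function vanishing almost everywhere on a face vanishes on its hyperplane. -/
theorem analytic_eq_zero_of_ae_face {d : ℕ} {a : E d} (ha : a ≠ 0) {b : ℝ} {F : Set (E d)}
    (hF : F ⊆ {x | inner ℝ a x = b}) (hFm : MeasurableSet F) (hpos : 0 < surface d F) {g : E d → ℝ}
    (hg : AnalyticOnNhd ℝ g univ) (h : ∀ᵐ x : F ∂(faceMeasure F), g x = 0) {x : E d}
    (hx : inner ℝ a x = b) : g x = 0 := by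
  rw [faceMeasure_ae_iff (p := fun x => g x = 0) hFm] at h
  subst hx
  -- The hyperplane is parametrised from `x` itself, so that the value sought is the one at
  -- parameter 0.
  rw [surface_eq_volume_preimage ha x hF] at hpos
  rw [surface_eq_volume_preimage ha x (inter_subset_left.trans hF)] at h
  have han : AnalyticOnNhd ℝ (fun w => g (hyperplaneParam a x w)) univ := by
    intro w _
    refine (hg _ (mem_univ _)).comp_of_eq (g := g) (f := hyperplaneParam a x) ?_ rfl
    exact analyticAt_const.add ((Submodule.span ℝ {a})ᗮ.subtypeL.analyticAt w)
  have := analytic_eq_zero_of_ae_of_pos volume han hpos.ne' h 0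
  simpa [hyperplaneParam] using this

/-- A set of diameter zero has at most one point, and points are null for a Hausdorff measure of
positive dimension; this needs d ≥ 2. It makes the weights `γ / Metric.diam F` of the stabilisation
positive. -/
theorem diam_pos_of_surface_pos {d : ℕ} (hd : 2 ≤ d) {F : Set (E d)}
    (hb : Bornology.IsBounded F) (hpos : 0 < surface d F) : 0 < Metric.diam F := by
  refine (Metric.diam_nonneg).lt_of_ne' fun h => ?_
  have hsub : F.Subsingleton := by
    intro x hx y hy
    exact dist_le_zero.1 (h ▸ Metric.dist_le_diam_of_mem hb hx hy)
  have hz : surface d F = 0 := by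
    have : NullSingletonClass (Measure.hausdorffMeasure (X := E d) ((d - 1 : ℕ) : ℝ)) :=
      Measure.nullSingletonClass_hausdorff (E d) (by
        have : 0 < d - 1 := by omega
        exact_mod_cast this)
    rw [surface, Measure.euclideanHausdorffMeasure_def, Measure.smul_apply, hsub.measure_zero,
      smul_zero]
  exact hpos.ne' hz

/-! ### Polynomial functions -/

/-- The coordinate functions. -/
def coordCLM {d : ℕ} (i : Fin d) : E d →L[ℝ] ℝ := EuclideanSpace.proj i

@[simp]
theorem coordCLM_apply {d : ℕ} (i : Fin d) (x : E d) : coordCLM i x = x i := rfl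

theorem mem_scalarPoly {d l : ℕ} {g : E d → ℝ} :
    g ∈ scalarPoly d l ↔ ∃ p : MvPolynomial (Fin d) ℝ, p.totalDegree ≤ l ∧
      ∀ x : E d, g x = MvPolynomial.aeval (fun i => x i) p := by
  simp only [scalarPoly, Submodule.mem_map, MvPolynomial.mem_restrictTotalDegree]
  constructor
  · rintro ⟨p, hp, rfl⟩
    exact ⟨p, hp, fun x => rfl⟩
  · rintro ⟨p, hp, h⟩
    exact ⟨p, hp, funext fun x => (h x).symm⟩

theorem scalarPoly_mono {d l m : ℕ} (h : l ≤ m) : scalarPoly d l ≤ scalarPoly d m := by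
  intro g hg
  obtain ⟨p, hp, hpg⟩ := mem_scalarPoly.1 hg
  exact mem_scalarPoly.2 ⟨p, hp.trans h, hpg⟩

theorem analyticOnNhd_of_mem_scalarPoly {d l : ℕ} {g : E d → ℝ} (hg : g ∈ scalarPoly d l) :
    AnalyticOnNhd ℝ g univ := by
  obtain ⟨p, -, hpg⟩ := mem_scalarPoly.1 hg
  rw [show g = fun x : E d => MvPolynomial.aeval (fun i => x i) p from funext hpg]
  refine AnalyticOnNhd.aeval_mvPolynomial (f := fun (x : E d) i => x i) (fun i x _ => ?_) p
  exact (coordCLM i).analyticAt x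

theorem differentiable_of_mem_scalarPoly {d l : ℕ} {g : E d → ℝ} (hg : g ∈ scalarPoly d l) :
    Differentiable ℝ g := fun x =>
  (analyticOnNhd_of_mem_scalarPoly hg x (mem_univ x)).differentiableAt

theorem continuous_of_mem_scalarPoly {d l : ℕ} {g : E d → ℝ} (hg : g ∈ scalarPoly d l) :
    Continuous g := (differentiable_of_mem_scalarPoly hg).continuous

/-- Each monomial of the derivative comes from one of `p` with an additional factor `X i`. The loss
of a degree is not needed. -/
theorem totalDegree_pderiv_le {ι : Type*} (i : ι) (p : MvPolynomial ι ℝ) :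
    (MvPolynomial.pderiv i p).totalDegree ≤ p.totalDegree := by
  classical
  refine Finset.sup_le fun m hm => ?_
  rw [MvPolynomial.mem_support_iff, MvPolynomial.coeff_pderiv] at hm
  have h := MvPolynomial.le_totalDegree (MvPolynomial.mem_support_iff.2 (left_ne_zero_of_mul hm))
  rw [Finsupp.sum_add_index (by simp) (by simp)] at h
  exact (Nat.le_add_right _ _).trans h

/-- Formal and analytic derivatives agree, by induction on `p` with the product rule. This is what
keeps gradients inside `scalarPoly`. -/
theorem hasFDerivAt_aeval {d : ℕ} (p : MvPolynomial (Fin d) ℝ) (x : E d) :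
    HasFDerivAt (fun x : E d => MvPolynomial.aeval (fun i => x i) p)
      (∑ i, (MvPolynomial.aeval (fun i => x i) (MvPolynomial.pderiv i p) : ℝ) •
        coordCLM i) x := by
  classical
  induction p using MvPolynomial.induction_on with
  | C c => simpa using hasFDerivAt_const c x
  | add p q hp hq =>
    have h := (hp.add hq).congr_fderiv (g' := ∑ i, (MvPolynomial.aeval (fun i => x i)
      (MvPolynomial.pderiv i (p + q)) : ℝ) • coordCLM i)
      (by simp only [map_add, add_smul, Finset.sum_add_distrib])
    simp only [map_add] at h ⊢
    exact h
  | mul_X p j hp =>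
    have hj : HasFDerivAt (fun y : E d => y j)
        (coordCLM j) x :=
      (coordCLM j).hasFDerivAt
    have h := (hp.mul hj).congr_fderiv (g' := ∑ i, (MvPolynomial.aeval (fun i => x i)
      (MvPolynomial.pderiv i (p * MvPolynomial.X j)) : ℝ) • coordCLM i) (by
        ext y
        have hX : ∀ i, (MvPolynomial.aeval fun i => x i)
            (MvPolynomial.pderiv i (MvPolynomial.X j : MvPolynomial (Fin d) ℝ))
            = if i = j then (1 : ℝ) else 0 := by
          intro i
          rw [MvPolynomial.pderiv_X, Pi.single_apply]
          by_cases h : i = j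
          · simp [h]
          · simp [h, Ne.symm h]
        simp only [MvPolynomial.pderiv_mul, map_add, map_mul, hX, MvPolynomial.aeval_X,
          sum_apply, add_apply, smul_apply,
          coordCLM_apply, smul_eq_mul, add_mul,
          Finset.sum_add_distrib, Finset.mul_sum, mul_ite, mul_one, mul_zero, ite_mul, zero_mul,
          Finset.sum_ite_eq', Finset.mem_univ, if_true]
        rw [add_comm]
        exact congrArg₂ _ (Finset.sum_congr rfl fun i _ => by ring) (by simp))
    simp only [map_mul, MvPolynomial.aeval_X] at h ⊢
    exact h

theorem fderiv_mem_scalarPoly {d l : ℕ} {g : E d → ℝ} (hg : g ∈ scalarPoly d l) (i : Fin d) :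
    (fun x => fderiv ℝ g x (EuclideanSpace.single i 1)) ∈ scalarPoly d l := by
  classical
  obtain ⟨p, hp, hpg⟩ := mem_scalarPoly.1 hg
  refine mem_scalarPoly.2 ⟨MvPolynomial.pderiv i p, (totalDegree_pderiv_le i p).trans hp, ?_⟩
  intro x
  rw [show g = fun x : E d => MvPolynomial.aeval (fun i => x i) p from funext hpg,
    (hasFDerivAt_aeval p x).fderiv]
  simp

theorem const_mem_scalarPoly (d l : ℕ) (c : ℝ) : (fun _ => c) ∈ scalarPoly d l :=
  mem_scalarPoly.2 ⟨MvPolynomial.C c, by simp, fun x => by simp⟩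

theorem coord_mem_scalarPoly {d l : ℕ} (hl : 1 ≤ l) (i : Fin d) :
    (fun x : E d => x i) ∈ scalarPoly d l :=
  mem_scalarPoly.2 ⟨MvPolynomial.X i, by simpa using hl, fun x => by simp⟩

theorem linear_mem_scalarPoly {d l : ℕ} (hl : 1 ≤ l) (φ : E d →ₗ[ℝ] ℝ) :
    (fun x : E d => φ x) ∈ scalarPoly d l := by
  have : (fun x : E d => φ x) = ∑ i, φ (EuclideanSpace.single i 1) • fun x : E d => x i := by
    funext x
    have hx : x = ∑ i, x i • EuclideanSpace.single i (1 : ℝ) := by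
      ext j
      simp [Pi.single_apply]
    conv_lhs => rw [hx]
    simp [mul_comm]
  rw [this]
  exact Submodule.sum_mem _ fun i _ => Submodule.smul_mem _ _ (coord_mem_scalarPoly hl i)

instance finiteDimensional_scalarPoly (d l : ℕ) : FiniteDimensional ℝ (scalarPoly d l) := by
  unfold scalarPoly
  infer_instance

instance finiteDimensional_vecPoly (d l : ℕ) : FiniteDimensional ℝ (vecPoly d l) := by
  let φ : vecPoly d l →ₗ[ℝ] (Fin d → scalarPoly d l) :=
    { toFun := fun v i => ⟨fun x => v.1 x i, v.2 i⟩
      map_add' := fun _ _ => rfl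
      map_smul' := fun _ _ => rfl }
  refine FiniteDimensional.of_injective φ fun v w h => ?_
  ext x i
  exact congrFun (congrArg Subtype.val (congrFun h i)) x

instance finiteDimensional_symPoly (d l : ℕ) : FiniteDimensional ℝ (symPoly d l) := by
  let φ : symPoly d l →ₗ[ℝ] (Fin d → Fin d → scalarPoly d l) :=
    { toFun := fun v i j => ⟨fun x => v.1 x i j, v.2.1 i j⟩
      map_add' := fun _ _ => rfl
      map_smul' := fun _ _ => rfl }
  refine FiniteDimensional.of_injective φ fun v w h => ?_
  ext x i j
  exact congrFun (congrArg Subtype.val (congrFun (congrFun h i) j)) x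

instance finiteDimensional_facePoly {d : ℕ} (l : ℕ) (F : Set (E d)) :
    FiniteDimensional ℝ (facePoly l F) := by
  unfold facePoly
  infer_instance

theorem continuous_of_mem_vecPoly {d l : ℕ} {v : E d → E d} (hv : v ∈ vecPoly d l) :
    Continuous v :=
  (PiLp.continuous_toLp 2 _).comp (continuous_pi fun i => continuous_of_mem_scalarPoly (hv i))

end

section

/-! ### Differential operators on polynomials -/

theorem grad_add {d l : ℕ} {v w : E d → E d} (hv : v ∈ vecPoly d l) (hw : w ∈ vecPoly d l)
    (x : E d) : grad (v + w) x = grad v x + grad w x := by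
  ext i j
  have : (fun y => (v + w) y j) = (fun y => v y j) + fun y => w y j := rfl
  simp only [grad, Matrix.of_apply, Matrix.add_apply]
  rw [this, fderiv_add (differentiable_of_mem_scalarPoly (hv j) x)
    (differentiable_of_mem_scalarPoly (hw j) x)]
  rfl

theorem grad_smul {d l : ℕ} {v : E d → E d} (hv : v ∈ vecPoly d l) (c : ℝ) (x : E d) :
    grad (c • v) x = c • grad v x := by
  ext i j
  have : (fun y => (c • v) y j) = c • fun y => v y j := rfl
  simp only [grad, Matrix.of_apply, Matrix.smul_apply]
  rw [this, fderiv_const_smul (differentiable_of_mem_scalarPoly (hv j) x)]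
  rfl

theorem grad_mem_scalarPoly {d l : ℕ} {v : E d → E d} (hv : v ∈ vecPoly d l) (i j : Fin d) :
    (fun x => grad v x i j) ∈ scalarPoly d l :=
  fderiv_mem_scalarPoly (hv j) i

theorem symGrad_mem {d l : ℕ} {v : E d → E d} (hv : v ∈ vecPoly d l) : symGrad v ∈ symPoly d l := by
  refine ⟨fun i j => ?_, fun x => ?_⟩
  · exact (scalarPoly d l).smul_mem (1 / 2 : ℝ)
      ((scalarPoly d l).add_mem (grad_mem_scalarPoly hv i j) (grad_mem_scalarPoly hv j i))
  · ext i j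
    simp [symGrad]
    ring

theorem skewGrad_mem_scalarPoly {d l : ℕ} {v : E d → E d} (hv : v ∈ vecPoly d l) (i j : Fin d) :
    (fun x => skewGrad v x i j) ∈ scalarPoly d l :=
  (scalarPoly d l).smul_mem (1 / 2 : ℝ)
    ((scalarPoly d l).sub_mem (grad_mem_scalarPoly hv i j) (grad_mem_scalarPoly hv j i))

theorem grad_eq_symGrad_add_skewGrad {d : ℕ} (v : E d → E d) (x : E d) :
    grad v x = symGrad v x + skewGrad v x := by
  ext i j
  simp [symGrad, skewGrad]
  ring

/-- The symmetric gradient as a linear map between polynomial spaces. -/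
def symGradLin (d l : ℕ) : vecPoly d l →ₗ[ℝ] symPoly d l where
  toFun v := ⟨symGrad v.1, symGrad_mem v.2⟩
  map_add' v w := by
    ext x : 2
    simp only [Submodule.coe_add, Pi.add_apply, symGrad]
    rw [grad_add v.2 w.2, Matrix.transpose_add]
    module
  map_smul' c v := by
    ext x : 2
    simp only [Submodule.coe_smul, Pi.smul_apply, symGrad, RingHom.id_apply]
    rw [grad_smul v.2, Matrix.transpose_smul]
    module

theorem skewGrad_add {d l : ℕ} {v w : E d → E d} (hv : v ∈ vecPoly d l) (hw : w ∈ vecPoly d l)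
    (x : E d) : skewGrad (v + w) x = skewGrad v x + skewGrad w x := by
  simp only [skewGrad]
  rw [grad_add hv hw, Matrix.transpose_add]
  module

theorem skewGrad_smul {d l : ℕ} {v : E d → E d} (hv : v ∈ vecPoly d l) (c : ℝ) (x : E d) :
    skewGrad (c • v) x = c • skewGrad v x := by
  simp only [skewGrad]
  rw [grad_smul hv, Matrix.transpose_smul]
  module

/-! ### Rigid motions -/

/-- Infinitesimal rigid motions. -/
def IsRigid {d : ℕ} (v : E d → E d) : Prop := ∀ x y, (inner ℝ (v x - v y) (x - y) : ℝ) = 0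

theorem inner_eq_sum {d : ℕ} (x y : E d) : (inner ℝ x y : ℝ) = ∑ i, x i * y i := by
  simp [PiLp.inner_apply, mul_comm]

theorem sum_coord_smul_single {d : ℕ} (x : E d) :
    x = ∑ i, x i • EuclideanSpace.single i (1 : ℝ) := by
  ext j
  simp [Pi.single_apply]

/-- With z = x - y, the derivative of v · z along the segment from y to x is the quadratic form of
the gradient at z. The gradient is skew, so this vanishes and v · z is the same at both ends. -/
theorem isRigid_of_symGrad_eq_zero {d l : ℕ} {v : E d → E d} (hv : v ∈ vecPoly d l)
    (h : ∀ x, symGrad v x = 0) : IsRigid v := by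
  intro x y
  set z := x - y with hz
  let φ : ℝ → ℝ := fun t => ∑ j, v (y + t • z) j * z j
  have hφ : ∀ t, HasDerivAt φ 0 t := by
    intro t
    have hline : HasDerivAt (fun t : ℝ => y + t • z) z t := by
      simpa using ((hasDerivAt_id t).smul_const z).const_add y
    have hj : ∀ j ∈ Finset.univ, HasDerivAt (fun t : ℝ => v (y + t • z) j * z j)
        (fderiv ℝ (fun y => v y j) (y + t • z) z * z j) t := fun j _ =>
      ((differentiable_of_mem_scalarPoly (hv j) (y + t • z)).hasFDerivAt.comp_hasDerivAt t
        hline).mul_const (z j)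
    have hsum := HasDerivAt.fun_sum hj
    refine hsum.congr_deriv ?_
    have hentry : ∀ j, fderiv ℝ (fun y => v y j) (y + t • z) z
        = ∑ i, z i * grad v (y + t • z) i j := by
      intro j
      conv_lhs => rw [show ∀ T : E d →L[ℝ] ℝ, T z = T (∑ i, z i • EuclideanSpace.single i (1 : ℝ)) from
        fun T => congrArg T (sum_coord_smul_single z)]
      rw [map_sum]
      simp [grad]
    have hskew : ∀ i j, grad v (y + t • z) i j = - grad v (y + t • z) j i := by
      intro i j
      have := congrFun (congrFun (h (y + t • z)) i) j
      simp [symGrad] at this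
      linarith
    simp only [hentry, Finset.sum_mul]
    have h1 : ∑ j, ∑ i, z i * grad v (y + t • z) i j * z j
        = -∑ j, ∑ i, z i * grad v (y + t • z) i j * z j := by
      conv_lhs => rw [Finset.sum_comm]
      rw [← Finset.sum_neg_distrib]
      refine Finset.sum_congr rfl fun j _ => ?_
      rw [← Finset.sum_neg_distrib]
      refine Finset.sum_congr rfl fun i _ => ?_
      rw [hskew j i]
      ring
    linarith
  have hconst : φ 1 = φ 0 := is_const_of_deriv_eq_zero (fun t => (hφ t).differentiableAt)
    (fun t => (hφ t).deriv) 1 0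
  simp only [φ, one_smul, zero_smul, add_zero, hz, add_sub_cancel] at hconst
  rw [inner_eq_sum]
  simp only [hz, PiLp.sub_apply, sub_mul, Finset.sum_sub_distrib] at hconst ⊢
  linarith

/-- Rigidity polarises to (v x - v 0) · y = -(v y - v 0) · x, whose right-hand side is linear in x.
No regularity of v enters. -/
theorem IsRigid.exists_linear {d : ℕ} {v : E d → E d} (h : IsRigid v) :
    ∃ φ : E d →ₗ[ℝ] E d, ∀ x, v x = v 0 + φ x := by
  have h0 : ∀ x, (inner ℝ (v x - v 0) x : ℝ) = 0 := fun x => by simpa using h x 0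
  have hs : ∀ x y, (inner ℝ (v x - v 0) y : ℝ) = - inner ℝ (v y - v 0) x := by
    intro x y
    have h1 := h x y
    have h2 := h0 x
    have h3 := h0 y
    simp only [inner_sub_left, inner_sub_right] at *
    linarith
  refine ⟨{ toFun := fun x => v x - v 0, map_add' := fun x y => ?_, map_smul' := fun c x => ?_ },
    fun x => ?_⟩
  · refine ext_inner_right ℝ fun z => ?_
    rw [inner_add_left, hs, hs x, hs y, inner_add_right]
    ring
  · refine ext_inner_right ℝ fun z => ?_
    rw [RingHom.id_apply, inner_smul_left, hs, hs x, inner_smul_right]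
    simp
  · simp

theorem mem_vecPoly_affine {d l : ℕ} (hl : 1 ≤ l) (c : E d) (φ : E d →ₗ[ℝ] E d) :
    (fun x => c + φ x) ∈ vecPoly d l := fun i =>
  (scalarPoly d l).add_mem (const_mem_scalarPoly d l (c i))
    (linear_mem_scalarPoly hl ((coordCLM i).toLinearMap ∘ₗ φ))

/-- Applied with l = k, this is where k ≥ 1 matters: the projections onto polynomials of degree k do
not alter rigid motions. -/
theorem IsRigid.mem_vecPoly {d l : ℕ} {v : E d → E d} (h : IsRigid v) (hl : 1 ≤ l) :
    v ∈ vecPoly d l := by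
  obtain ⟨φ, hφ⟩ := h.exists_linear
  rw [funext hφ]
  exact mem_vecPoly_affine hl _ φ

theorem grad_affine {d : ℕ} (c : E d) (φ : E d →ₗ[ℝ] E d) (x : E d) (i j : Fin d) :
    grad (fun x => c + φ x) x i j = φ (EuclideanSpace.single i 1) j := by
  let ψ : E d →L[ℝ] ℝ := (coordCLM j).comp (LinearMap.toContinuousLinearMap φ)
  have h : HasFDerivAt (fun y => (c + φ y) j) ψ x := by
    have : (fun y => (c + φ y) j) = fun y => c j + ψ y := rfl
    rw [this]
    exact ψ.hasFDerivAt.const_add (c j)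
  simp only [grad, Matrix.of_apply]
  rw [h.fderiv]
  rfl

/-- A rigid motion vanishing on a hyperplane is zero. -/
theorem IsRigid.eq_zero_of_hyperplane {d : ℕ} {v : E d → E d} (h : IsRigid v) {A : Set (E d)}
    (hA : IsHyperplane A) (hv : ∀ x ∈ A, v x = 0) : v = 0 := by
  obtain ⟨a, ha, b, rfl⟩ := hA
  have haa : (inner ℝ a a : ℝ) ≠ 0 := inner_self_ne_zero.2 ha
  funext x
  by_cases hx : inner ℝ a x = b
  · exact hv x hx
  -- For `x` off the hyperplane, rigidity makes `v x` orthogonal to all `x - y` with `y` on it, and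
  -- these vectors span the space: differences give the directions of the hyperplane, and `x - y₀`
  -- is transversal to it.
  have hin : ∀ y, inner ℝ a y = b → (inner ℝ (v x) (x - y) : ℝ) = 0 := by
    intro y hy
    simpa [hv y hy] using h x y
  set y₀ : E d := (b / inner ℝ a a) • a with hy₀
  have hy₀A : inner ℝ a y₀ = b := by
    rw [hy₀, inner_smul_right]
    field_simp
  have horth : ∀ z, inner ℝ a z = (0 : ℝ) → (inner ℝ (v x) z : ℝ) = 0 := by
    intro z hz
    have h1 := hin y₀ hy₀A
    have h2 := hin (y₀ + z) (by rw [inner_add_right, hy₀A, hz, add_zero])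
    rw [inner_sub_right] at h1 h2
    rw [inner_add_right] at h2
    linarith
  have hxy : (inner ℝ a (x - y₀) : ℝ) ≠ 0 := by
    rw [inner_sub_right, hy₀A]
    exact sub_ne_zero.2 hx
  refine ext_inner_right ℝ fun w => ?_
  set s : ℝ := inner ℝ a w / inner ℝ a (x - y₀) with hs
  have h3 := horth (w - s • (x - y₀)) (by
    rw [inner_sub_right, inner_smul_right, hs, div_mul_cancel₀ _ hxy, sub_self])
  rw [inner_sub_right, inner_smul_right, hin y₀ hy₀A] at h3
  simpa using h3

end

section

/-! ### Propagation of properties through the faces of a mesh -/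

theorem IsHyperplane.volume_eq_zero {d : ℕ} {A : Set (E d)} (hA : IsHyperplane A) :
    volume A = 0 := by
  obtain ⟨a, ha, b, rfl⟩ := hA
  have haa : (inner ℝ a a : ℝ) ≠ 0 := inner_self_ne_zero.2 ha
  have han : AnalyticOnNhd ℝ (fun x : E d => (inner ℝ a x : ℝ) - b) univ := fun x _ =>
    ((innerSL ℝ a).analyticAt x).sub analyticAt_const
  have := measure_zeros_eq_zero volume han (x₀ := ((b + 1) / inner ℝ a a) • a) (by
    simp only [inner_smul_right]
    rw [div_mul_cancel₀ _ haa]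
    norm_num)
  simpa [sub_eq_zero] using this

theorem exists_mem_forall_notMem_hyperplane {d : ℕ} {U : Set (E d)} (hU : IsOpen U)
    (hne : U.Nonempty) {𝒜 : Set (Set (E d))} (hf : 𝒜.Finite) (hA : ∀ A ∈ 𝒜, IsHyperplane A) :
    ∃ x ∈ U, ∀ A ∈ 𝒜, x ∉ A := by
  by_contra! h
  have h0 : volume (⋃₀ 𝒜) = 0 :=
    (measure_sUnion_null_iff hf.countable).2 fun A hA' => (hA A hA').volume_eq_zero
  exact (hU.measure_pos volume hne).ne'
    (measure_mono_null (fun x hx => mem_sUnion.2 (h x hx)) h0)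

/-- If near a point of the frontier of an open set `T` the frontier lies in a hyperplane, then `T`
contains one of the two half balls. -/
theorem halfBall_subset {d : ℕ} {T : Set (E d)} (hT : IsOpen T) {x a : E d} {b r : ℝ} (hr : 0 < r)
    (ha : a ≠ 0) (hx : x ∈ frontier T)
    (hfr : ∀ y ∈ Metric.ball x r, y ∈ frontier T → inner ℝ a y = b) :
    (Metric.ball x r ∩ {y | b < inner ℝ a y} ⊆ T) ∨ (Metric.ball x r ∩ {y | inner ℝ a y < b} ⊆ T) := by
  have haa : 0 < (inner ℝ a a : ℝ) := real_inner_self_pos.2 ha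
  -- The part of the ball in `H` is connected and free of frontier points, so once it meets `T` it
  -- cannot leave it.
  have hsub : ∀ H : Set (E d), Convex ℝ H → (∀ y ∈ H, (inner ℝ a y : ℝ) ≠ b) →
      (Metric.ball x r ∩ H ∩ T).Nonempty → Metric.ball x r ∩ H ⊆ T := by
    intro H hH hne hmeet
    refine ((convex_ball x r).inter hH).isPreconnected.subset_left_of_subset_union hT
      isClosed_closure.isOpen_compl (disjoint_compl_right_iff_subset.2 subset_closure)
      (fun y hy => ?_) hmeet
    by_contra hcon
    simp only [mem_union, mem_compl_iff, not_or, not_not] at hcon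
    exact hne y hy.2 (hfr y hy.1 ⟨hcon.2, by rw [hT.interior_eq]; exact hcon.1⟩)
  have hcl : x ∈ closure T := frontier_subset_closure hx
  obtain ⟨y, hyB, hyT⟩ := mem_closure_iff.1 hcl _ Metric.isOpen_ball (Metric.mem_ball_self hr)
  have hopen : IsOpen (Metric.ball x r ∩ T) := Metric.isOpen_ball.inter hT
  have hlin : IsLinearMap ℝ fun y : E d => (inner ℝ a y : ℝ) := (innerSL ℝ a).toLinearMap.isLinear
  have hgt := hsub _ (convex_halfSpace_gt hlin b) (fun y hy => ne_of_gt hy)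
  have hlt := hsub _ (convex_halfSpace_lt hlin b) (fun y hy => ne_of_lt hy)
  rcases lt_trichotomy (inner ℝ a y) b with h | h | h
  · exact Or.inr (hlt ⟨y, ⟨hyB, h⟩, hyT⟩)
  -- A point of the open set `T` on the hyperplane itself is first pushed off along `a`.
  · have hlim : Tendsto (fun s : ℝ => y + s • a) (𝓝[>] 0) (𝓝 (y + (0 : ℝ) • a)) :=
      (Continuous.tendsto (by fun_prop) 0).mono_left nhdsWithin_le_nhds
    obtain ⟨s, hs, hs0⟩ := ((hlim.eventually (hopen.mem_nhds (by simpa using ⟨hyB, hyT⟩))).and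
      self_mem_nhdsWithin).exists
    refine Or.inl (hgt ⟨y + s • a, ⟨hs.1, ?_⟩, hs.2⟩)
    have : 0 < s * (inner ℝ a a : ℝ) := mul_pos hs0 haa
    simp only [mem_ofPred_eq, inner_add_right, inner_smul_right]
    linarith
  · exact Or.inl (hgt ⟨y, ⟨hyB, h⟩, hyT⟩)

/-- Given finitely many hyperplanes, from each open set there starts a ray that crosses them
transversally and never meets two of them at once. -/
theorem exists_generic_ray {d : ℕ} (hd : d ≠ 0) {𝒜 : Set (Set (E d))} (hf : 𝒜.Finite)
    (hA : ∀ A ∈ 𝒜, IsHyperplane A) {U : Set (E d)} (hU : IsOpen U) (hne : U.Nonempty) :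
    ∃ x ∈ U, ∃ e : E d, e ≠ 0 ∧
      (∀ A ∈ 𝒜, ∃ a : E d, ∃ b : ℝ, (inner ℝ a e : ℝ) ≠ 0 ∧ A = {x | inner ℝ a x = b}) ∧
      ∀ A ∈ 𝒜, ∀ A' ∈ 𝒜, ∀ t : ℝ, x + t • e ∈ A → x + t • e ∈ A' → A = A' := by
  classical
  have : Nontrivial (E d) := by
    have : Nonempty (Fin d) := ⟨⟨0, Nat.pos_of_ne_zero hd⟩⟩
    infer_instance
  choose! a ha b hab using hA
  -- The direction is chosen first, off the translates of the hyperplanes through the origin; the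
  -- starting point is chosen afterwards.
  obtain ⟨e, he, hea⟩ := exists_mem_forall_notMem_hyperplane (d := d) (U := {0}ᶜ)
    isOpen_compl_singleton (exists_ne (0 : E d)) (hf.image fun A => {x | inner ℝ (a A) x = (0 : ℝ)})
    (by rintro _ ⟨A, hA, rfl⟩; exact ⟨a A, ha A hA, 0, rfl⟩)
  have hea' : ∀ A ∈ 𝒜, (inner ℝ (a A) e : ℝ) ≠ 0 := fun A hA h => hea _ ⟨A, hA, rfl⟩ h
  -- Eliminating `t` from the equations for `x + t • e` to lie on both hyperplanes leaves ⟨c, x⟩ =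
  -- β, a condition on `x` alone. If `c ≠ 0` it is avoided by the choice of `x`; if `c = 0` the
  -- hyperplanes are parallel, and a common point makes them equal.
  let c : Set (E d) × Set (E d) → E d := fun p =>
    (inner ℝ (a p.2) e : ℝ) • a p.1 - (inner ℝ (a p.1) e : ℝ) • a p.2
  let β : Set (E d) × Set (E d) → ℝ := fun p =>
    (inner ℝ (a p.2) e : ℝ) * b p.1 - (inner ℝ (a p.1) e : ℝ) * b p.2
  obtain ⟨x, hx, hxa⟩ := exists_mem_forall_notMem_hyperplane hU hne
    (((hf.prod hf).subset (sep_subset (𝒜 ×ˢ 𝒜) fun p => c p ≠ 0)).image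
      fun p => {x | inner ℝ (c p) x = β p})
    (by rintro _ ⟨p, hp, rfl⟩; exact ⟨c p, hp.2, β p, rfl⟩)
  refine ⟨x, hx, e, he, fun A hA => ⟨a A, b A, hea' A hA, hab A hA⟩, fun A hA A' hA' t h h' => ?_⟩
  have h1 : (inner ℝ (a A) (x + t • e) : ℝ) = b A := by rw [hab A hA] at h; exact h
  have h2 : (inner ℝ (a A') (x + t • e) : ℝ) = b A' := by rw [hab A' hA'] at h'; exact h'
  by_cases hc : c (A, A') = 0
  · have hprop : ∀ w, (inner ℝ (a A') e : ℝ) * inner ℝ (a A) w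
        = (inner ℝ (a A) e : ℝ) * inner ℝ (a A') w := by
      intro w
      have : (inner ℝ (c (A, A')) w : ℝ) = 0 := by rw [hc, inner_zero_left]
      simp only [c, inner_sub_left, inner_smul_left] at this
      simpa [sub_eq_zero] using this
    rw [hab A hA, hab A' hA']
    ext z
    simp only [mem_ofPred_eq]
    have h3 := hprop (z - (x + t • e))
    rw [inner_sub_right, inner_sub_right, h1, h2] at h3
    constructor
    · intro hz
      rw [hz, sub_self, mul_zero] at h3
      exact sub_eq_zero.1 ((mul_eq_zero.1 h3.symm).resolve_left (hea' A hA))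
    · intro hz
      rw [hz, sub_self, mul_zero] at h3
      exact sub_eq_zero.1 ((mul_eq_zero.1 h3).resolve_left (hea' A' hA'))
  · refine absurd ?_ (hxa _ ⟨(A, A'), ⟨⟨hA, hA'⟩, hc⟩, rfl⟩)
    simp only [mem_ofPred_eq, c, β, inner_sub_left, inner_smul_left, inner_add_right,
      inner_smul_right] at h1 h2 ⊢
    simp only [conj_trivial]
    rw [← h1, ← h2]
    ring

/-- A property of mesh elements that holds next to boundary faces and passes from one element to
another through common faces holds for all elements. -/
theorem PolytopalMesh.forall_of_propagate {d : ℕ} (hd : d ≠ 0) {Ω : Set (E d)}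
    (𝓜 : PolytopalMesh Ω) (P : Set (E d) → Prop)
    (hbd : ∀ T ∈ 𝓜.elements, ∀ F ∈ 𝓜.faces, F ⊆ frontier T →
      (∃ T' ∈ 𝓜.elements, F ⊆ frontier T' ∩ frontier Ω) → P T)
    (hint : ∀ T₁ ∈ 𝓜.elements, ∀ T₂ ∈ 𝓜.elements, ∀ F ∈ 𝓜.faces, F ⊆ frontier T₁ →
      F ⊆ frontier T₂ → P T₁ → P T₂) : ∀ T ∈ 𝓜.elements, P T := by
  classical
  by_contra! hcon
  obtain ⟨T₀, hT₀, hP₀⟩ := hcon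
  have hfs := fun T hT => (𝓜.element_polyhedron T hT).frontier_subset
  choose! 𝒜' hfin hhyp hcov using hfs
  set 𝒜 : Set (Set (E d)) := ⋃ T ∈ 𝓜.elements, 𝒜' T with h𝒜
  have h𝒜f : 𝒜.Finite := 𝓜.elements.finite_toSet.biUnion fun T hT => hfin T hT
  have h𝒜h : ∀ A ∈ 𝒜, IsHyperplane A := by
    intro A hA
    obtain ⟨T, hT, hAT⟩ := mem_iUnion₂.1 hA
    exact hhyp T hT A hAT
  have h𝒜c : ∀ T ∈ 𝓜.elements, ∀ x ∈ frontier T, ∃ A ∈ 𝒜, x ∈ A := by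
    intro T hT x hx
    obtain ⟨A, hA, hxA⟩ := hcov T hT hx
    exact ⟨A, mem_iUnion₂.2 ⟨T, hT, hA⟩, hxA⟩
  obtain ⟨x₀, hx₀, e, he, htr, hgen⟩ := exists_generic_ray hd h𝒜f h𝒜h
    (𝓜.element_polyhedron T₀ hT₀).isOpen (𝓜.element_nonempty T₀ hT₀)
  -- The bad region. It is compact, and the generic ray is followed to its last point `γ t` in it.
  let W : Set (E d) := ⋃ T ∈ (𝓜.elements.filter fun T => ¬ P T), closure T
  have hWc : IsCompact W := Finset.isCompact_biUnion _ fun T hT =>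
    (𝓜.element_polyhedron T (Finset.mem_filter.1 hT).1).isBounded.isCompact_closure
  have hmemW : ∀ T ∈ 𝓜.elements, ¬ P T → ∀ x ∈ closure T, x ∈ W := fun T hT hP x hx =>
    mem_iUnion₂.2 ⟨T, Finset.mem_filter.2 ⟨hT, hP⟩, hx⟩
  let γ : ℝ → E d := fun t => x₀ + t • e
  have hγ : Continuous γ := by fun_prop
  have hγa : AntilipschitzWith ‖e‖₊⁻¹ γ := by
    refine AntilipschitzWith.of_le_mul_dist fun s t => ?_
    have hne : ‖e‖ ≠ 0 := norm_ne_zero_iff.2 he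
    have hdist : dist (γ s) (γ t) = dist s t * ‖e‖ := by
      rw [dist_add_left, dist_eq_norm, ← sub_smul, norm_smul, dist_eq_norm]
    rw [hdist, NNReal.coe_inv, coe_nnnorm, mul_comm (dist s t), inv_mul_cancel_left₀ hne]
  have hcomp : IsCompact (γ ⁻¹' W) :=
    Metric.isCompact_of_isClosed_isBounded (hWc.isClosed.preimage hγ)
      (hγa.isBounded_preimage hWc.isBounded)
  obtain ⟨t, htW, htmax⟩ := hcomp.exists_isGreatest
    ⟨0, hmemW T₀ hT₀ hP₀ _ (subset_closure (by simpa [γ] using hx₀))⟩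
  have hnext : ∀ T ∈ 𝓜.elements, ¬ P T → ∀ s > t, γ s ∉ T := fun T hT hP s hs h =>
    (htmax (hmemW T hT hP _ (subset_closure h))).not_gt hs
  obtain ⟨T, hTf, hTx⟩ := mem_iUnion₂.1 (show γ t ∈ W from htW)
  obtain ⟨hT, hPT⟩ := Finset.mem_filter.1 hTf
  have hnot : γ t ∉ T := by
    intro h
    have hev : ∀ᶠ s in 𝓝[>] t, γ s ∈ T :=
      (hγ.tendsto t).mono_left nhdsWithin_le_nhds
        ((𝓜.element_polyhedron T hT).isOpen.mem_nhds h)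
    obtain ⟨s, hs, hst⟩ := (hev.and self_mem_nhdsWithin).exists
    exact hnext T hT hPT s hst hs
  have hfr : γ t ∈ frontier T := ⟨hTx, by rwa [(𝓜.element_polyhedron T hT).isOpen.interior_eq]⟩
  have hfr' := hfr
  rw [𝓜.frontier_eq T hT] at hfr'
  obtain ⟨F, ⟨hF, hFT⟩, hxF⟩ := hfr'
  rcases 𝓜.face_cases F hF with ⟨T₁, hT₁, T₂, hT₂, hne, hF12⟩ | hb
  swap
  · exact hPT (hbd T hT F hF hFT hb)
  have hF1 : F ⊆ frontier T₁ := hF12.trans inter_subset_left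
  have hF2 : F ⊆ frontier T₂ := hF12.trans inter_subset_right
  -- `T` is bad and shares `F` with both `T₁` and `T₂`, so these are bad too. It plays no role
  -- whether `T` is one of them.
  have hP1 : ¬ P T₁ := fun h => hPT (hint T₁ hT₁ T hT F hF hF1 hFT h)
  have hP2 : ¬ P T₂ := fun h => hPT (hint T₂ hT₂ T hT F hF hF2 hFT h)
  obtain ⟨A, hA, hxA⟩ := h𝒜c T hT _ hfr
  -- By genericity `A` is the only hyperplane through `γ t`, hence the only one that meets a small
  -- ball around it.
  obtain ⟨r, hr, hball⟩ : ∃ r > 0, ∀ y ∈ Metric.ball (γ t) r, ∀ A' ∈ 𝒜, y ∈ A' → A' = A := by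
    have hcl : IsClosed (⋃₀ (𝒜 \ {A})) := by
      rw [sUnion_eq_biUnion]
      refine (h𝒜f.subset sdiff_subset).isClosed_biUnion fun A' hA' => ?_
      obtain ⟨a, -, b, rfl⟩ := h𝒜h A' hA'.1
      exact isClosed_eq (continuous_const.inner continuous_id) continuous_const
    have hx : γ t ∈ (⋃₀ (𝒜 \ {A}))ᶜ := by
      rintro ⟨A', ⟨hA', hA'A⟩, hxA'⟩
      exact hA'A (hgen A' hA' A hA t hxA' hxA)
    obtain ⟨r, hr, hrs⟩ := Metric.isOpen_iff.1 hcl.isOpen_compl _ hx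
    refine ⟨r, hr, fun y hy A' hA' hyA' => ?_⟩
    by_contra hneA
    exact hrs hy ⟨A', ⟨hA', hneA⟩, hyA'⟩
  obtain ⟨a, b, hae, rfl⟩ := htr A hA
  have ha : a ≠ 0 := by
    rintro rfl
    simp at hae
  have hfrA : ∀ T ∈ 𝓜.elements, ∀ y ∈ Metric.ball (γ t) r, y ∈ frontier T → inner ℝ a y = b := by
    intro T hT y hy hyT
    obtain ⟨A', hA', hyA'⟩ := h𝒜c T hT y hyT
    rw [hball y hy A' hA' hyA'] at hyA'
    exact hyA'
  have hh1 := halfBall_subset (𝓜.element_polyhedron T₁ hT₁).isOpen hr ha (hF1 hxF) (hfrA T₁ hT₁)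
  have hh2 := halfBall_subset (𝓜.element_polyhedron T₂ hT₂).isOpen hr ha (hF2 hxF) (hfrA T₂ hT₂)
  have hdis := 𝓜.element_disjoint T₁ hT₁ T₂ hT₂ hne
  have hxb : (inner ℝ a (γ t) : ℝ) = b := hxA
  have hinγ : ∀ s, (inner ℝ a (γ s) : ℝ) = b + (s - t) * inner ℝ a e := by
    intro s
    rw [← hxb]
    simp only [γ, inner_add_right, inner_smul_right]
    ring
  have hlims : ∀ l : Filter ℝ, l ≤ 𝓝 t → ∀ᶠ s in l, γ s ∈ Metric.ball (γ t) r := fun l hl =>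
    (hγ.tendsto t).mono_left hl (Metric.ball_mem_nhds _ hr)
  obtain ⟨s, hs, hst⟩ := ((hlims (𝓝[>] t) nhdsWithin_le_nhds).and self_mem_nhdsWithin).exists
  obtain ⟨s', hs', hst'⟩ := ((hlims (𝓝[<] t) nhdsWithin_le_nhds).and self_mem_nhdsWithin).exists
  have hn1 := hnext T₁ hT₁ hP1 s hst
  have hn2 := hnext T₂ hT₂ hP2 s hst
  rw [Set.disjoint_left] at hdis
  -- The half ball ahead contains `γ s` with `s > t`, which no bad element may contain. Both `T₁`
  -- and `T₂` thus contain the half ball behind, and with it `γ s'`.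
  rcases lt_or_gt_of_ne hae with hlt | hgt
  · have hsH : γ s ∈ Metric.ball (γ t) r ∩ {y | (inner ℝ a y : ℝ) < b} :=
      ⟨hs, by simp only [mem_ofPred_eq]; rw [hinγ]; nlinarith⟩
    have hsH' : γ s' ∈ Metric.ball (γ t) r ∩ {y | b < (inner ℝ a y : ℝ)} :=
      ⟨hs', by simp only [mem_ofPred_eq]; rw [hinγ]; nlinarith⟩
    exact hdis ((hh1.resolve_right fun h => hn1 (h hsH)) hsH')
      ((hh2.resolve_right fun h => hn2 (h hsH)) hsH')
  · have hsH : γ s ∈ Metric.ball (γ t) r ∩ {y | b < (inner ℝ a y : ℝ)} :=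
      ⟨hs, by simp only [mem_ofPred_eq]; rw [hinγ]; nlinarith⟩
    have hsH' : γ s' ∈ Metric.ball (γ t) r ∩ {y | (inner ℝ a y : ℝ) < b} :=
      ⟨hs', by simp only [mem_ofPred_eq]; rw [hinγ]; nlinarith⟩
    exact hdis ((hh1.resolve_left fun h => hn1 (h hsH)) hsH')
      ((hh2.resolve_left fun h => hn2 (h hsH)) hsH')

end

section

/-! ### Frobenius product -/

theorem frob_add_left {d : ℕ} (a b c : Mat d) : frob (a + b) c = frob a c + frob b c := by
  simp [frob, add_mul, Finset.sum_add_distrib]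

theorem frob_smul_left {d : ℕ} (r : ℝ) (a b : Mat d) : frob (r • a) b = r * frob a b := by
  simp [frob, Finset.mul_sum, mul_assoc]

theorem frob_comm {d : ℕ} (a b : Mat d) : frob a b = frob b a := by
  simp [frob, mul_comm]

theorem frob_add_right {d : ℕ} (a b c : Mat d) : frob a (b + c) = frob a b + frob a c := by
  rw [frob_comm, frob_add_left, frob_comm b, frob_comm c]

theorem frob_smul_right {d : ℕ} (r : ℝ) (a b : Mat d) : frob a (r • b) = r * frob a b := by
  rw [frob_comm, frob_smul_left, frob_comm]

theorem frob_sub_left {d : ℕ} (a b c : Mat d) : frob (a - b) c = frob a c - frob b c := by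
  simp [frob, sub_mul, Finset.sum_sub_distrib]

theorem frob_sub_right {d : ℕ} (a b c : Mat d) : frob a (b - c) = frob a b - frob a c := by
  rw [frob_comm, frob_sub_left, frob_comm b, frob_comm c]

@[simp]
theorem frob_zero_left {d : ℕ} (a : Mat d) : frob 0 a = 0 := by simp [frob]

theorem frob_self_nonneg {d : ℕ} (a : Mat d) : 0 ≤ frob a a :=
  Finset.sum_nonneg fun _ _ => Finset.sum_nonneg fun _ _ => mul_self_nonneg _

theorem frob_self_eq_zero {d : ℕ} {a : Mat d} (h : frob a a = 0) : a = 0 := by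
  ext i j
  have h1 := (Finset.sum_eq_zero_iff_of_nonneg fun i _ =>
    Finset.sum_nonneg fun j _ => mul_self_nonneg (a i j)).1 h i (Finset.mem_univ i)
  have h2 := (Finset.sum_eq_zero_iff_of_nonneg fun j _ => mul_self_nonneg (a i j)).1 h1 j
    (Finset.mem_univ j)
  exact mul_self_eq_zero.1 h2

theorem frobNorm_sq {d : ℕ} (a : Mat d) : frobNorm a ^ 2 = frob a a :=
  Real.sq_sqrt (frob_self_nonneg a)

theorem continuous_frob {d : ℕ} {α : Type*} [TopologicalSpace α] {f g : α → Mat d}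
    (hf : ∀ i j, Continuous fun x => f x i j) (hg : ∀ i j, Continuous fun x => g x i j) :
    Continuous fun x => frob (f x) (g x) :=
  continuous_finsetSum _ fun i _ => continuous_finsetSum _ fun j _ => (hf i j).mul (hg i j)

theorem continuous_entry_of_mem_symPoly {d l : ℕ} {τ : E d → Mat d} (h : τ ∈ symPoly d l)
    (i j : Fin d) : Continuous fun x => τ x i j :=
  continuous_of_mem_scalarPoly (h.1 i j)

/-! ### Integration on elements and faces -/

theorem integrableOn_of_continuous {d : ℕ} {T : Set (E d)} (hb : Bornology.IsBounded T)
    {g : E d → ℝ} (hg : Continuous g) : IntegrableOn g T :=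
  (hg.continuousOn.integrableOn_compact hb.isCompact_closure).mono_set subset_closure

theorem PolytopalMesh.face_isCompact {d : ℕ} {Ω : Set (E d)} (𝓜 : PolytopalMesh Ω)
    {F : Set (E d)} (hF : F ∈ 𝓜.faces) : IsCompact F := by
  refine Metric.isCompact_of_isClosed_isBounded (𝓜.face_closed F hF) ?_
  rcases 𝓜.face_cases F hF with ⟨T, hT, _, _, _, h⟩ | ⟨T, hT, h⟩
  · exact (𝓜.element_polyhedron T hT).isBounded.closure.subset
      ((h.trans inter_subset_left).trans frontier_subset_closure)
  · exact (𝓜.element_polyhedron T hT).isBounded.closure.subset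
      ((h.trans inter_subset_left).trans frontier_subset_closure)

theorem PolytopalMesh.isFiniteMeasure_face {d : ℕ} {Ω : Set (E d)} (𝓜 : PolytopalMesh Ω)
    {F : Set (E d)} (hF : F ∈ 𝓜.faces) : IsFiniteMeasure (faceMeasure F) := by
  obtain ⟨A, hA, hFA⟩ := 𝓜.face_hyperplanar F hF
  refine ⟨?_⟩
  rw [faceMeasure,
    (MeasurableEmbedding.subtype_coe (𝓜.face_closed F hF).measurableSet).comap_apply]
  erw [image_univ, Subtype.range_coe]
  exact surface_lt_top hA hFA (𝓜.face_isCompact hF).isBounded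

theorem PolytopalMesh.integrable_face {d : ℕ} {Ω : Set (E d)} (𝓜 : PolytopalMesh Ω)
    {F : Set (E d)} (hF : F ∈ 𝓜.faces) {g : F → ℝ} (hg : Continuous g) :
    Integrable g (faceMeasure F) := by
  have := isCompact_iff_compactSpace.1 (𝓜.face_isCompact hF)
  have := 𝓜.isFiniteMeasure_face hF
  exact (BoundedContinuousFunction.mkOfCompact ⟨g, hg⟩).integrable (faceMeasure F)

/-- The polynomial spaces consist of functions on the whole space, so vanishing on T has to be
propagated beyond T; analyticity does this. -/
theorem eq_zero_of_ae_element {d l : ℕ} {T : Set (E d)} (hT : IsOpen T) (hne : T.Nonempty)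
    {g : E d → ℝ} (hg : g ∈ scalarPoly d l) (h : ∀ᵐ x ∂(volume.restrict T), g x = 0) : g = 0 := by
  funext x
  refine analytic_eq_zero_of_ae_of_pos volume (analyticOnNhd_of_mem_scalarPoly hg) (s := T)
    (hT.measure_pos volume hne).ne' ?_ x
  rw [ae_restrict_iff' hT.measurableSet, ae_iff] at h
  convert h using 2
  ext x
  simp

theorem eq_zero_of_integral_frob_eq_zero {d l : ℕ} {T : Set (E d)} (hT : IsOpen T)
    (hb : Bornology.IsBounded T) (hne : T.Nonempty) {τ : E d → Mat d} (hτ : τ ∈ symPoly d l)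
    (h : ∫ x in T, frob (τ x) (τ x) = 0) : τ = 0 := by
  have hint := integrableOn_of_continuous hb (continuous_frob (continuous_entry_of_mem_symPoly hτ)
    (continuous_entry_of_mem_symPoly hτ))
  have hae := (integral_eq_zero_iff_of_nonneg (fun x => frob_self_nonneg (τ x)) hint).1 h
  have hz : ∀ i j, (fun x => τ x i j) = 0 := fun i j =>
    eq_zero_of_ae_element hT hne (hτ.1 i j) (hae.mono fun x hx => by
      simp [frob_self_eq_zero hx])
  ext x i j
  exact congrFun (hz i j) x

theorem eq_zero_of_integral_inner_element {d l : ℕ} {T : Set (E d)} (hT : IsOpen T)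
    (hb : Bornology.IsBounded T) (hne : T.Nonempty) {v : E d → E d} (hv : v ∈ vecPoly d l)
    (h : ∫ x in T, (inner ℝ (v x) (v x) : ℝ) = 0) : v = 0 := by
  have hc := continuous_of_mem_vecPoly hv
  have hint := integrableOn_of_continuous hb (hc.inner hc)
  have hae := (integral_eq_zero_iff_of_nonneg (fun x => real_inner_self_nonneg) hint).1 h
  have hz : ∀ i, (fun x => v x i) = 0 := fun i =>
    eq_zero_of_ae_element hT hne (hv i) (hae.mono fun x hx => by
      have : v x = 0 := inner_self_eq_zero.1 hx
      simp [this])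
  ext x i
  exact congrFun (hz i) x

theorem continuous_of_mem_facePoly {d l : ℕ} {F : Set (E d)} {p : F → E d}
    (hp : p ∈ facePoly l F) : Continuous p := by
  obtain ⟨v, hv, rfl⟩ := hp
  exact (continuous_of_mem_vecPoly hv).comp continuous_subtype_val

theorem restrict_mem_facePoly {d l : ℕ} {F : Set (E d)} {v : E d → E d} (hv : v ∈ vecPoly d l) :
    (fun x : F => v x) ∈ facePoly l F := ⟨v, hv, rfl⟩

/-- A vector polynomial that vanishes almost everywhere on a face vanishes on any hyperplane
containing that face. -/
theorem PolytopalMesh.eq_zero_of_ae_face {d l : ℕ} {Ω : Set (E d)} (𝓜 : PolytopalMesh Ω)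
    {F A : Set (E d)} (hF : F ∈ 𝓜.faces) (hA : IsHyperplane A) (hFA : F ⊆ A) {v : E d → E d}
    (hv : v ∈ vecPoly d l) (h : ∀ᵐ x : F ∂(faceMeasure F), v x = 0) : ∀ x ∈ A, v x = 0 := by
  obtain ⟨a, ha, b, rfl⟩ := hA
  intro x hx
  ext i
  exact analytic_eq_zero_of_ae_face ha hFA (𝓜.face_closed F hF).measurableSet (𝓜.face_pos F hF)
    (analyticOnNhd_of_mem_scalarPoly (hv i)) (h.mono fun y hy => by simp [hy]) hx

/-- A polynomial representing `p` vanishes almost everywhere on the face, hence on its whole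
hyperplane. So `p` vanishes at every point of the face, not just almost everywhere. -/
theorem PolytopalMesh.eq_zero_of_integral_inner_face {d l : ℕ} {Ω : Set (E d)}
    (𝓜 : PolytopalMesh Ω) {F : Set (E d)} (hF : F ∈ 𝓜.faces) {p : F → E d}
    (hp : p ∈ facePoly l F)
    (h : ∫ x, (inner ℝ (p x) (p x) : ℝ) ∂(faceMeasure F) = 0) : p = 0 := by
  have hc := continuous_of_mem_facePoly hp
  have hae := (integral_eq_zero_iff_of_nonneg (fun x => real_inner_self_nonneg)
    (𝓜.integrable_face hF (hc.inner hc))).1 h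
  obtain ⟨v, hv, rfl⟩ := hp
  obtain ⟨A, hA, hFA⟩ := 𝓜.face_hyperplanar F hF
  funext x
  exact 𝓜.eq_zero_of_ae_face hF hA hFA hv (hae.mono fun y hy => inner_self_eq_zero.1 hy) x
    (hFA x.2)

/-! ### Orthogonal projections -/

section Projection

variable {d : ℕ} {α : Type*} [MeasurableSpace α] {μ : Measure α}
  {P : Submodule ℝ (α → E d)}

/-- The defining property of the orthogonal projection. -/
def IsL2Proj (μ : Measure α) (P : Submodule ℝ (α → E d)) (w p : α → E d) : Prop :=
  p ∈ P ∧ ∀ q ∈ P, ∫ x, (inner ℝ (p x - w x) (q x) : ℝ) ∂μ = 0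

theorem IsL2Proj.smul (c : ℝ) {w p : α → E d} (h : IsL2Proj μ P w p) :
    IsL2Proj μ P (c • w) (c • p) := by
  refine ⟨P.smul_mem c h.1, fun q hq => ?_⟩
  simp only [Pi.smul_apply, ← smul_sub, inner_smul_left]
  rw [integral_const_mul, h.2 q hq, mul_zero]

theorem isL2Proj_self {p : α → E d} (h : p ∈ P) : IsL2Proj μ P p p :=
  ⟨h, fun q _ => by simp⟩

variable [TopologicalSpace α]

/-- The `L²(μ)` inner product on a space of continuous functions. -/
def innerForm (hμ : ∀ g : α → ℝ, Continuous g → Integrable g μ) (hP : ∀ p ∈ P, Continuous p) :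
    P →ₗ[ℝ] P →ₗ[ℝ] ℝ :=
  LinearMap.mk₂ ℝ (fun p q => ∫ x, (inner ℝ (p.1 x) (q.1 x) : ℝ) ∂μ)
    (fun p p' q => by
      rw [← integral_add (hμ _ ((hP _ p.2).inner (hP _ q.2))) (hμ _ ((hP _ p'.2).inner (hP _ q.2)))]
      simp [inner_add_left])
    (fun c p q => by
      rw [← integral_smul]
      simp [inner_smul_left])
    (fun p q q' => by
      rw [← integral_add (hμ _ ((hP _ p.2).inner (hP _ q.2))) (hμ _ ((hP _ p.2).inner (hP _ q'.2)))]
      simp [inner_add_right])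
    (fun c p q => by
      rw [← integral_smul]
      simp [inner_smul_right])

/-- The difference of two candidates lies in `P` and is orthogonal to itself. -/
theorem l2Proj_eq (hμ : ∀ g : α → ℝ, Continuous g → Integrable g μ) (hP : ∀ p ∈ P, Continuous p)
    (hdef : ∀ p ∈ P, ∫ x, (inner ℝ (p x) (p x) : ℝ) ∂μ = 0 → p = 0) {w p : α → E d}
    (hw : Continuous w) (hp : IsL2Proj μ P w p) : l2Proj μ P w = p := by
  refine epsilon_eq_of_unique (R := IsL2Proj μ P w) hp fun q q' hq hq' => ?_
  have hmem := P.sub_mem hq.1 hq'.1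
  refine sub_eq_zero.1 (hdef _ hmem ?_)
  have h1 := hq.2 _ hmem
  have h2 := hq'.2 _ hmem
  have := integral_sub (hμ _ (((hP _ hq.1).sub hw).inner (hP _ hmem)))
    (hμ _ (((hP _ hq'.1).sub hw).inner (hP _ hmem)))
  simp only [Pi.sub_apply] at this h1 h2
  rw [h1, h2, sub_zero] at this
  rw [← this]
  refine integral_congr_ae (Eventually.of_forall fun x => ?_)
  simp only [Pi.sub_apply]
  rw [← inner_sub_left, sub_sub_sub_cancel_right]

/-- Existence is the representation of q ↦ ∫ w · q by the definite inner product of `P`. -/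
theorem isL2Proj_l2Proj [FiniteDimensional ℝ P]
    (hμ : ∀ g : α → ℝ, Continuous g → Integrable g μ) (hP : ∀ p ∈ P, Continuous p)
    (hdef : ∀ p ∈ P, ∫ x, (inner ℝ (p x) (p x) : ℝ) ∂μ = 0 → p = 0) {w : α → E d}
    (hw : Continuous w) : IsL2Proj μ P w (l2Proj μ P w) := by
  let ℓ : P →ₗ[ℝ] ℝ :=
    { toFun := fun q => ∫ x, (inner ℝ (w x) (q.1 x) : ℝ) ∂μ
      map_add' := fun q q' => by
        rw [← integral_add (hμ _ (hw.inner (hP _ q.2))) (hμ _ (hw.inner (hP _ q'.2)))]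
        simp [inner_add_right]
      map_smul' := fun c q => by
        rw [RingHom.id_apply, ← integral_smul]
        simp [inner_smul_right] }
  obtain ⟨p, hp⟩ := exists_forall_eq_of_posDef (innerForm hμ hP)
    (fun u hu => Subtype.ext (hdef u.1 u.2 hu)) ℓ
  have hpp : IsL2Proj μ P w p.1 := by
    refine ⟨p.2, fun q hq => ?_⟩
    have h : ∫ x, (inner ℝ (p.1 x) (q x) : ℝ) ∂μ = ∫ x, (inner ℝ (w x) (q x) : ℝ) ∂μ :=
      hp ⟨q, hq⟩
    simp only [inner_sub_left]
    rw [integral_sub (hμ _ ((hP _ p.2).inner (hP _ hq))) (hμ _ (hw.inner (hP _ hq))), h, sub_self]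
  rw [l2Proj_eq hμ hP hdef hw hpp]
  exact hpp

theorem IsL2Proj.add (hμ : ∀ g : α → ℝ, Continuous g → Integrable g μ)
    (hP : ∀ p ∈ P, Continuous p) {w w' p p' : α → E d} (hw : Continuous w) (hw' : Continuous w')
    (h : IsL2Proj μ P w p) (h' : IsL2Proj μ P w' p') : IsL2Proj μ P (w + w') (p + p') := by
  refine ⟨P.add_mem h.1 h'.1, fun q hq => ?_⟩
  have := integral_add (hμ _ (((hP _ h.1).sub hw).inner (hP _ hq)))
    (hμ _ (((hP _ h'.1).sub hw').inner (hP _ hq)))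
  simp only [Pi.sub_apply] at this
  rw [h.2 q hq, h'.2 q hq, add_zero] at this
  rw [← this]
  refine integral_congr_ae (Eventually.of_forall fun x => ?_)
  simp only [Pi.add_apply]
  rw [← inner_add_left, add_sub_add_comm]

end Projection

end

section

/-! ### Linear functionals defined by integrals -/

/-- Integration of a linear family of integrable functions. -/
def integralLin {V α : Type*} [AddCommGroup V] [Module ℝ V] [MeasurableSpace α] (μ : Measure α)
    (g : V →ₗ[ℝ] α → ℝ) (hg : ∀ v, Integrable (g v) μ) : V →ₗ[ℝ] ℝ where
  toFun v := ∫ x, g v x ∂μ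
  map_add' v w := by
    rw [← integral_add (hg v) (hg w), map_add]
    rfl
  map_smul' c v := by
    rw [RingHom.id_apply, ← integral_smul, map_smul]
    rfl

/-- Integration of a bilinear family of integrable functions. -/
def integralBilin {V W α : Type*} [AddCommGroup V] [Module ℝ V] [AddCommGroup W] [Module ℝ W]
    [MeasurableSpace α] (μ : Measure α) (g : V →ₗ[ℝ] W →ₗ[ℝ] α → ℝ)
    (hg : ∀ v w, Integrable (g v w) μ) : V →ₗ[ℝ] W →ₗ[ℝ] ℝ :=
  LinearMap.mk₂ ℝ (fun v w => ∫ x, g v w x ∂μ)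
    (fun v v' w => by
      rw [← integral_add (hg v w) (hg v' w), map_add]
      rfl)
    (fun c v w => by
      rw [← integral_smul, map_smul]
      rfl)
    (fun v w w' => by
      rw [← integral_add (hg v w) (hg v w'), map_add]
      rfl)
    (fun c v w => by
      rw [← integral_smul, map_smul]
      rfl)

/-- The `L²(T)` inner product of tensor-valued polynomials. -/
def frobForm {d : ℕ} {T : Set (E d)} (hb : Bornology.IsBounded T) (l : ℕ) :
    symPoly d l →ₗ[ℝ] symPoly d l →ₗ[ℝ] ℝ :=
  integralBilin (volume.restrict T)
    (LinearMap.mk₂ ℝ (fun τ η x => frob (τ.1 x) (η.1 x))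
      (fun _ _ _ => funext fun _ => frob_add_left _ _ _)
      (fun _ _ _ => funext fun _ => frob_smul_left _ _ _)
      (fun _ _ _ => funext fun _ => frob_add_right _ _ _)
      (fun _ _ _ => funext fun _ => frob_smul_right _ _ _))
    fun τ η => integrableOn_of_continuous hb (continuous_frob
      (continuous_entry_of_mem_symPoly τ.2) (continuous_entry_of_mem_symPoly η.2))

theorem frobForm_apply {d : ℕ} {T : Set (E d)} (hb : Bornology.IsBounded T) (l : ℕ)
    (τ η : symPoly d l) : frobForm hb l τ η = ∫ x in T, frob (τ.1 x) (η.1 x) := rfl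

/-- The integral over `T` of a component of a vector polynomial. -/
def meanLin {d : ℕ} {T : Set (E d)} (hb : Bornology.IsBounded T) (l : ℕ) (i : Fin d) :
    vecPoly d l →ₗ[ℝ] ℝ :=
  integralLin (volume.restrict T)
    { toFun := fun v x => v.1 x i
      map_add' := fun _ _ => rfl
      map_smul' := fun _ _ => rfl }
    fun v => integrableOn_of_continuous hb (continuous_of_mem_scalarPoly (v.2 i))

theorem meanLin_apply {d : ℕ} {T : Set (E d)} (hb : Bornology.IsBounded T) (l : ℕ) (i : Fin d)
    (v : vecPoly d l) : meanLin hb l i v = ∫ x in T, v.1 x i := rfl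

/-- The integral over `T` of an entry of the skew-symmetric part of the gradient. -/
def skewMeanLin {d : ℕ} {T : Set (E d)} (hb : Bornology.IsBounded T) (l : ℕ) (i j : Fin d) :
    vecPoly d l →ₗ[ℝ] ℝ :=
  integralLin (volume.restrict T)
    { toFun := fun v x => skewGrad v.1 x i j
      map_add' := fun v w => funext fun x => congrFun (congrFun (skewGrad_add v.2 w.2 x) i) j
      map_smul' := fun c v => funext fun x => congrFun (congrFun (skewGrad_smul v.2 c x) i) j }
    fun v => integrableOn_of_continuous hb
      (continuous_of_mem_scalarPoly (skewGrad_mem_scalarPoly v.2 i j))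

theorem skewMeanLin_apply {d : ℕ} {T : Set (E d)} (hb : Bornology.IsBounded T) (l : ℕ)
    (i j : Fin d) (v : vecPoly d l) :
    skewMeanLin hb l i j v = ∫ x in T, skewGrad v.1 x i j := rfl

/-! ### Linearity of the reconstructions -/

variable {d : ℕ} {Ω : Set (E d)} {𝓜 : PolytopalMesh Ω} {k : ℕ}

theorem isBounded_element (T : {T // T ∈ 𝓜.elements}) : Bornology.IsBounded T.1 :=
  (𝓜.element_polyhedron T.1 T.2).isBounded

theorem isOpen_element (T : {T // T ∈ 𝓜.elements}) : IsOpen T.1 :=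
  (𝓜.element_polyhedron T.1 T.2).isOpen

theorem nonempty_element (T : {T // T ∈ 𝓜.elements}) : T.1.Nonempty :=
  𝓜.element_nonempty T.1 T.2

theorem volume_real_element_pos (T : {T // T ∈ 𝓜.elements}) : 0 < volume.real T.1 :=
  ENNReal.toReal_pos ((isOpen_element T).measure_pos volume (nonempty_element T)).ne'
    (isBounded_element T).measure_lt_top.ne

theorem Dofs.continuous_face (v : Dofs 𝓜 k) (F : {F // F ∈ 𝓜.faces}) : Continuous (v.face F) :=
  continuous_of_mem_facePoly (v.2 F).2

theorem Dofs.continuous_elem (v : Dofs 𝓜 k) (T : {T // T ∈ 𝓜.elements}) :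
    Continuous (v.elem T) :=
  continuous_of_mem_vecPoly (v.1 T).2

/-- The element components as linear maps. -/
def elemLin (T : {T // T ∈ 𝓜.elements}) : Dofs 𝓜 k →ₗ[ℝ] vecPoly d k :=
  LinearMap.proj T ∘ₗ LinearMap.fst ℝ _ _

/-- The contribution of a face to the symmetric gradient reconstruction. -/
def faceForm (T : {T // T ∈ 𝓜.elements}) (F : {F // F ∈ 𝓜.faces}) :
    Dofs 𝓜 k →ₗ[ℝ] symPoly d k →ₗ[ℝ] ℝ :=
  integralBilin (faceMeasure F.1)
    (LinearMap.mk₂ ℝ (fun v τ (x : F.1) => ∑ i, (v.face F x i - v.elem T x i) *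
        (τ.1 x).mulVec (fun j => normal T.1 F.1 j) i)
      (fun v v' τ => funext fun x => by
        simp only [Pi.add_apply]
        rw [← Finset.sum_add_distrib]
        refine Finset.sum_congr rfl fun i _ => ?_
        have h1 : (v + v').face F x i = v.face F x i + v'.face F x i := rfl
        have h2 : (v + v').elem T x i = v.elem T x i + v'.elem T x i := rfl
        rw [h1, h2]
        ring)
      (fun c v τ => funext fun x => by
        simp only [Pi.smul_apply, smul_eq_mul]
        rw [Finset.mul_sum]
        refine Finset.sum_congr rfl fun i _ => ?_
        have h1 : (c • v).face F x i = c * v.face F x i := rfl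
        have h2 : (c • v).elem T x i = c * v.elem T x i := rfl
        rw [h1, h2]
        ring)
      (fun v τ τ' => funext fun x => by
        simp only [Submodule.coe_add, Pi.add_apply, Matrix.add_mulVec, mul_add,
          Finset.sum_add_distrib])
      (fun c v τ => funext fun x => by
        simp only [Submodule.coe_smul, Pi.smul_apply, Matrix.smul_mulVec, smul_eq_mul,
          Finset.mul_sum]
        exact Finset.sum_congr rfl fun i _ => by ring))
    fun v τ => 𝓜.integrable_face F.2 (by
      change Continuous fun x : F.1 => ∑ i, (v.face F x i - v.elem T x i) *
        (τ.1 x).mulVec (fun j => normal T.1 F.1 j) i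
      refine continuous_finsetSum _ fun i _ => ((((coordCLM i).continuous.comp
        (v.continuous_face F)).sub ((coordCLM i).continuous.comp
          ((v.continuous_elem T).comp continuous_subtype_val))).mul ?_)
      simp only [Matrix.mulVec, dotProduct]
      exact continuous_finsetSum _ fun j _ =>
        ((continuous_entry_of_mem_symPoly τ.2 i j).comp continuous_subtype_val).mul
          continuous_const)

/-- The right-hand side of the problem defining the symmetric gradient reconstruction. -/
def gradRhs (T : {T // T ∈ 𝓜.elements}) : Dofs 𝓜 k →ₗ[ℝ] symPoly d k →ₗ[ℝ] ℝ :=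
  frobForm (isBounded_element T) k ∘ₗ symGradLin d k ∘ₗ elemLin T +
    ∑ F ∈ facesOf 𝓜 T, faceForm T F

theorem gradRhs_apply (T : {T // T ∈ 𝓜.elements}) (v : Dofs 𝓜 k) (τ : symPoly d k) :
    gradRhs T v τ = (∫ x in T.1, frob (symGrad (v.elem T) x) (τ.1 x)) +
      ∑ F ∈ facesOf 𝓜 T, (∫ x : F.1, (∑ i, (v.face F x i - v.elem T x i) *
        (τ.1 x).mulVec (fun j => normal T.1 F.1 j) i) ∂(faceMeasure F.1)) := by
  simp only [gradRhs, LinearMap.add_apply, LinearMap.sum_apply]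
  rfl

theorem frobForm_definite (T : {T // T ∈ 𝓜.elements}) {l : ℕ} (τ : symPoly d l)
    (h : frobForm (isBounded_element T) l τ τ = 0) : τ = 0 :=
  Subtype.ext (eq_zero_of_integral_frob_eq_zero (isOpen_element T) (isBounded_element T)
    (nonempty_element T) τ.2 h)

/-- The L²(T) product is definite on a space of finite dimension, so the defining problem is
solvable and `Classical.epsilon` picks a solution. -/
theorem symGradRec_spec (v : Dofs 𝓜 k) (T : {T // T ∈ 𝓜.elements}) :
    ∃ h : symGradRec v T ∈ symPoly d k, ∀ τ : symPoly d k,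
      frobForm (isBounded_element T) k ⟨symGradRec v T, h⟩ τ = gradRhs T v τ := by
  obtain ⟨G, hG⟩ := exists_forall_eq_of_posDef (frobForm (isBounded_element T) k)
    (frobForm_definite T) (gradRhs T v)
  have hex : ∃ G : E d → Mat d, G ∈ symPoly d k ∧ ∀ τ ∈ symPoly d k,
      ∫ x in T.1, frob (G x) (τ x) =
      (∫ x in T.1, frob (symGrad (v.elem T) x) (τ x)) +
      ∑ F ∈ facesOf 𝓜 T, (∫ x : F.1, (∑ i, (v.face F x i - v.elem T x i) *
        (τ x).mulVec (fun j => normal T.1 F.1 j) i) ∂(faceMeasure F.1)) :=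
    ⟨G.1, G.2, fun τ hτ => (hG ⟨τ, hτ⟩).trans (gradRhs_apply T v ⟨τ, hτ⟩)⟩
  have hspec := Classical.epsilon_spec hex
  exact ⟨hspec.1, fun τ => (hspec.2 τ.1 τ.2).trans (gradRhs_apply T v τ).symm⟩

/-- Uniqueness of the reconstruction, from which its linearity in v follows although it was defined
by a choice. -/
theorem frobForm_ext (T : {T // T ∈ 𝓜.elements}) {l : ℕ} {G G' : symPoly d l}
    (h : ∀ τ, frobForm (isBounded_element T) l G τ = frobForm (isBounded_element T) l G' τ) :
    G = G' := by
  refine sub_eq_zero.1 (frobForm_definite T _ ?_)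
  rw [LinearMap.map_sub₂, h, sub_self]

/-- The symmetric gradient reconstruction as a linear map. -/
def symGradRecLin (T : {T // T ∈ 𝓜.elements}) : Dofs 𝓜 k →ₗ[ℝ] symPoly d k where
  toFun v := ⟨symGradRec v T, (symGradRec_spec v T).choose⟩
  map_add' v w := frobForm_ext T fun τ => by
    rw [(symGradRec_spec _ T).choose_spec, map_add, map_add, LinearMap.add_apply,
      LinearMap.add_apply, (symGradRec_spec _ T).choose_spec, (symGradRec_spec _ T).choose_spec]
  map_smul' c v := frobForm_ext T fun τ => by
    rw [(symGradRec_spec _ T).choose_spec, map_smul, RingHom.id_apply, map_smul,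
      LinearMap.smul_apply, LinearMap.smul_apply, (symGradRec_spec _ T).choose_spec]

theorem frobForm_symGradRecLin (T : {T // T ∈ 𝓜.elements}) (v : Dofs 𝓜 k) (τ : symPoly d k) :
    frobForm (isBounded_element T) k (symGradRecLin T v) τ = gradRhs T v τ :=
  (symGradRec_spec v T).choose_spec τ

/-- The right-hand side prescribing the mean value of the skew-symmetric gradient. -/
def skewFaceLin (T : {T // T ∈ 𝓜.elements}) (i j : Fin d) : Dofs 𝓜 k →ₗ[ℝ] ℝ :=
  ∑ F ∈ facesOf 𝓜 T, integralLin (faceMeasure F.1)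
    { toFun := fun v (x : F.1) => (1 / 2 : ℝ) *
        (normal T.1 F.1 i * v.face F x j - v.face F x i * normal T.1 F.1 j)
      map_add' := fun v v' => funext fun x => by
        have h (i) : (v + v').face F x i = v.face F x i + v'.face F x i := rfl
        simp only [Pi.add_apply, h]
        ring
      map_smul' := fun c v => funext fun x => by
        have h (i) : (c • v).face F x i = c * v.face F x i := rfl
        simp only [Pi.smul_apply, smul_eq_mul, h, RingHom.id_apply]
        ring }
    fun v => 𝓜.integrable_face F.2 (by
      have h (i) : Continuous fun x => v.face F x i :=
        (coordCLM i).continuous.comp (v.continuous_face F)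
      exact continuous_const.mul ((continuous_const.mul (h j)).sub ((h i).mul continuous_const)))

theorem skewFaceLin_apply (T : {T // T ∈ 𝓜.elements}) (i j : Fin d) (v : Dofs 𝓜 k) :
    skewFaceLin T i j v = ∑ F ∈ facesOf 𝓜 T, (∫ x : F.1, (1 / 2 : ℝ) *
        (normal T.1 F.1 i * v.face F x j - v.face F x i * normal T.1 F.1 j) ∂(faceMeasure F.1)) := by
  simp only [skewFaceLin, LinearMap.sum_apply]
  rfl

/-- Compatibility of the data: only skew mean values can be matched by a rotation. -/
theorem skewFaceLin_swap (T : {T // T ∈ 𝓜.elements}) (i j : Fin d) (v : Dofs 𝓜 k) :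
    skewFaceLin T i j v = - skewFaceLin T j i v := by
  rw [skewFaceLin_apply, skewFaceLin_apply, ← Finset.sum_neg_distrib]
  refine Finset.sum_congr rfl fun F _ => ?_
  rw [← integral_neg]
  refine integral_congr_ae (Eventually.of_forall fun x => ?_)
  simp only
  ring

theorem symPoly_mono {l m : ℕ} (h : l ≤ m) : symPoly d l ≤ symPoly d m := fun _ hτ =>
  ⟨fun i j => scalarPoly_mono h (hτ.1 i j), hτ.2⟩

/-- The defining property of the displacement reconstruction. -/
def IsDispRec (T : {T // T ∈ 𝓜.elements}) (v : Dofs 𝓜 k) (r : vecPoly d (k + 1)) : Prop :=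
  (∀ w : vecPoly d (k + 1), frobForm (isBounded_element T) (k + 1)
    (symGradLin d (k + 1) r - Submodule.inclusion (symPoly_mono k.le_succ) (symGradRecLin T v))
      (symGradLin d (k + 1) w) = 0) ∧
  (∀ i, meanLin (isBounded_element T) (k + 1) i r = meanLin (isBounded_element T) k i (elemLin T v)) ∧
  ∀ i j, skewMeanLin (isBounded_element T) (k + 1) i j r = skewFaceLin T i j v

theorem IsDispRec.add {T : {T // T ∈ 𝓜.elements}} {v v' : Dofs 𝓜 k} {r r' : vecPoly d (k + 1)}
    (h : IsDispRec T v r) (h' : IsDispRec T v' r') : IsDispRec T (v + v') (r + r') := by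
  refine ⟨fun w => ?_, fun i => ?_, fun i j => ?_⟩
  · rw [map_add, map_add, map_add, add_sub_add_comm, map_add, LinearMap.add_apply, h.1, h'.1,
      add_zero]
  · rw [map_add, map_add, map_add, h.2.1, h'.2.1]
  · rw [map_add, map_add, h.2.2, h'.2.2]

theorem IsDispRec.smul {T : {T // T ∈ 𝓜.elements}} {v : Dofs 𝓜 k} {r : vecPoly d (k + 1)}
    (h : IsDispRec T v r) (c : ℝ) : IsDispRec T (c • v) (c • r) := by
  refine ⟨fun w => ?_, fun i => ?_, fun i j => ?_⟩
  · have e : symGradLin d (k + 1) (c • r) - Submodule.inclusion (symPoly_mono k.le_succ)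
        (symGradRecLin T (c • v)) = c • (symGradLin d (k + 1) r -
          Submodule.inclusion (symPoly_mono k.le_succ) (symGradRecLin T v)) := by
      rw [map_smul, map_smul, map_smul]
      exact (smul_sub _ _ _).symm
    rw [e, LinearMap.map_smul₂, h.1, smul_zero]
  · rw [map_smul, map_smul, map_smul, h.2.1]
  · rw [map_smul, map_smul, h.2.2]

/-- A zero symmetric gradient leaves a rigid motion; the skew mean kills its linear part, and the
mean then kills the constant. -/
theorem eq_zero_of_means_eq_zero (T : {T // T ∈ 𝓜.elements}) {l : ℕ} (r : vecPoly d l)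
    (hs : symGradLin d l r = 0) (hm : ∀ i, meanLin (isBounded_element T) l i r = 0)
    (hk : ∀ i j, skewMeanLin (isBounded_element T) l i j r = 0) : r = 0 := by
  have hs' : ∀ x, symGrad r.1 x = 0 := fun x => congrFun (congrArg Subtype.val hs) x
  obtain ⟨φ, hφ⟩ := (isRigid_of_symGrad_eq_zero r.2 hs').exists_linear
  have hvol := volume_real_element_pos T
  have hgrad : ∀ x i j, grad r.1 x i j = φ (EuclideanSpace.single i 1) j := by
    intro x i j
    rw [funext hφ, grad_affine]
  have hskew : ∀ i j, φ (EuclideanSpace.single i 1) j = 0 := by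
    intro i j
    have h1 : ∀ x, skewGrad r.1 x i j = φ (EuclideanSpace.single i 1) j := by
      intro x
      have := congrFun (congrFun (grad_eq_symGrad_add_skewGrad r.1 x) i) j
      rw [hs' x, zero_add, hgrad] at this
      exact this.symm
    have h2 := hk i j
    rw [skewMeanLin_apply] at h2
    simp only [h1, setIntegral_const, smul_eq_mul] at h2
    exact (mul_eq_zero.1 h2).resolve_left hvol.ne'
  have hφ0 : ∀ x, φ x = 0 := by
    intro x
    rw [sum_coord_smul_single x, map_sum]
    refine Finset.sum_eq_zero fun i _ => ?_
    rw [map_smul]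
    have : φ (EuclideanSpace.single i 1) = 0 := by
      ext j
      exact hskew i j
    rw [this, smul_zero]
  have hconst : ∀ x, r.1 x = r.1 0 := fun x => by rw [hφ x, hφ0, add_zero]
  refine Subtype.ext (funext fun x => ?_)
  ext i
  have h3 := hm i
  rw [meanLin_apply] at h3
  rw [setIntegral_congr_fun (isOpen_element T).measurableSet fun x _ => by
    rw [hconst x], setIntegral_const, smul_eq_mul] at h3
  rw [hconst x]
  exact (mul_eq_zero.1 h3).resolve_left hvol.ne'

/-- Testing both strain identities with r - r' shows that its symmetric gradient is zero, and the
two mean conditions exclude rigid motions. -/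
theorem IsDispRec.unique {T : {T // T ∈ 𝓜.elements}} {v : Dofs 𝓜 k} {r r' : vecPoly d (k + 1)}
    (h : IsDispRec T v r) (h' : IsDispRec T v r') : r = r' := by
  refine sub_eq_zero.1 (eq_zero_of_means_eq_zero T _ (frobForm_definite T _ ?_) (fun i => ?_)
    fun i j => ?_)
  · have h1 := h.1 (r - r')
    have h2 := h'.1 (r - r')
    rw [map_sub (frobForm _ _), LinearMap.sub_apply, sub_eq_zero] at h1 h2
    conv_lhs => rw [map_sub (symGradLin d (k + 1)) r r', map_sub (frobForm _ _), LinearMap.sub_apply]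
    rw [← map_sub (symGradLin d (k + 1)) r r', h1, h2, sub_self]
  · rw [map_sub, h.2.1, h'.2.1, sub_self]
  · rw [map_sub, h.2.2, h'.2.2, sub_self]

/-- The linear map with gradient `M`. -/
def linOfGrad (M : Mat d) : E d →ₗ[ℝ] E d :=
  ∑ i, (coordCLM i).toLinearMap.smulRight (WithLp.toLp 2 (M i) : E d)

theorem linOfGrad_single (M : Mat d) (i j : Fin d) :
    linOfGrad M (EuclideanSpace.single i 1) j = M i j := by
  simp [linOfGrad]

/-- The form is definite on the range of the symmetric gradient, so the projection is taken there
and then lifted; the lift is free up to rigid motions. -/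
theorem exists_symGrad_projection (T : {T // T ∈ 𝓜.elements}) {l : ℕ} (G : symPoly d l) :
    ∃ r : vecPoly d l, ∀ w : vecPoly d l,
      frobForm (isBounded_element T) l (symGradLin d l r - G) (symGradLin d l w) = 0 := by
  let W := LinearMap.range (symGradLin d l)
  let B : W →ₗ[ℝ] W →ₗ[ℝ] ℝ := (frobForm (isBounded_element T) l).domRestrict₁₂ W W
  have hB : ∀ p q : W, B p q = frobForm (isBounded_element T) l p.1 q.1 := fun p q =>
    LinearMap.domRestrict₁₂_apply _ W W p q
  obtain ⟨p, hp⟩ := exists_forall_eq_of_posDef B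
    (fun u hu => Subtype.ext (frobForm_definite T _ ((hB u u).symm.trans hu)))
    ((frobForm (isBounded_element T) l G).domRestrict W)
  obtain ⟨r, hr⟩ := p.2
  refine ⟨r, fun w => ?_⟩
  have h := hp ⟨symGradLin d l w, LinearMap.mem_range_self _ w⟩
  rw [hB, LinearMap.domRestrict_apply] at h
  rw [LinearMap.map_sub₂, sub_eq_zero, hr]
  exact h

/-- The linear field with constant gradient S / |T| works: a skew gradient has no symmetric part. -/
theorem exists_rotation (T : {T // T ∈ 𝓜.elements}) {l : ℕ} (hl : 1 ≤ l) (S : Mat d)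
    (hS : ∀ i j, S i j = - S j i) : ∃ r : vecPoly d l, symGradLin d l r = 0 ∧
      ∀ i j, skewMeanLin (isBounded_element T) l i j r = S i j := by
  have hvol := volume_real_element_pos T
  let M : Mat d := fun i j => (volume.real T.1)⁻¹ * S i j
  have hM : ∀ i j, M i j = - M j i := fun i j => by
    simp only [M]
    rw [hS i j, mul_neg]
  let v : E d → E d := fun x => 0 + linOfGrad M x
  have hgrad : ∀ x i j, grad v x i j = M i j := fun x i j => by
    rw [grad_affine, linOfGrad_single]
  refine ⟨⟨v, mem_vecPoly_affine hl 0 (linOfGrad M)⟩, ?_, fun i j => ?_⟩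
  · refine Subtype.ext (funext fun x => ?_)
    change symGrad v x = 0
    ext i j
    simp only [symGrad, Matrix.smul_apply, Matrix.add_apply, Matrix.transpose_apply, hgrad]
    rw [hM i j]
    simp
  · rw [skewMeanLin_apply]
    have : ∀ x, skewGrad v x i j = M i j := by
      intro x
      simp only [skewGrad, Matrix.smul_apply, Matrix.sub_apply, Matrix.transpose_apply, hgrad,
        smul_eq_mul]
      rw [hM j i]
      ring
    simp only [this, setIntegral_const, smul_eq_mul, M]
    rw [mul_inv_cancel_left₀ hvol.ne']

theorem exists_translation (T : {T // T ∈ 𝓜.elements}) {l : ℕ} (hl : 1 ≤ l) (m : Fin d → ℝ) :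
    ∃ r : vecPoly d l, symGradLin d l r = 0 ∧
      (∀ i, meanLin (isBounded_element T) l i r = m i) ∧
      ∀ i j, skewMeanLin (isBounded_element T) l i j r = 0 := by
  have hvol := volume_real_element_pos T
  let c : E d := WithLp.toLp 2 fun i => (volume.real T.1)⁻¹ * m i
  let v : E d → E d := fun x => c + (0 : E d →ₗ[ℝ] E d) x
  have hgrad : ∀ x, grad v x = 0 := fun x => by
    ext i j
    rw [grad_affine]
    rfl
  refine ⟨⟨v, mem_vecPoly_affine hl c 0⟩, ?_, fun i => ?_, fun i j => ?_⟩
  · refine Subtype.ext (funext fun x => ?_)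
    change symGrad v x = 0
    simp [symGrad, hgrad]
  · rw [meanLin_apply]
    simp only [v, LinearMap.zero_apply, add_zero, setIntegral_const, smul_eq_mul, c]
    rw [mul_inv_cancel_left₀ hvol.ne']
  · rw [skewMeanLin_apply]
    simp [skewGrad, hgrad]

theorem skewMeanLin_swap (T : {T // T ∈ 𝓜.elements}) {l : ℕ} (i j : Fin d) (r : vecPoly d l) :
    skewMeanLin (isBounded_element T) l i j r = - skewMeanLin (isBounded_element T) l j i r := by
  rw [skewMeanLin_apply, skewMeanLin_apply, ← integral_neg]
  refine integral_congr_ae (Eventually.of_forall fun x => ?_)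
  simp only [skewGrad, Matrix.smul_apply, Matrix.sub_apply, Matrix.transpose_apply, smul_eq_mul]
  ring

/-- A field with the right strain is corrected by a rotation to fix the skew mean, then by a
translation to fix the mean. The order matters, since the rotation affects the mean but the
translation leaves the skew mean unchanged. -/
theorem exists_isDispRec (T : {T // T ∈ 𝓜.elements}) (v : Dofs 𝓜 k) : ∃ r, IsDispRec T v r := by
  obtain ⟨r₀, hr₀⟩ := exists_symGrad_projection T
    (Submodule.inclusion (symPoly_mono k.le_succ) (symGradRecLin T v))
  obtain ⟨r₁, hs₁, hk₁⟩ := exists_rotation T (Nat.le_add_left 1 k)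
    (fun i j => skewFaceLin T i j v - skewMeanLin (isBounded_element T) (k + 1) i j r₀)
    (fun i j => by
      rw [skewFaceLin_swap, skewMeanLin_swap]
      ring)
  obtain ⟨r₂, hs₂, hm₂, hk₂⟩ := exists_translation T (Nat.le_add_left 1 k)
    (fun i => meanLin (isBounded_element T) k i (elemLin T v)
      - meanLin (isBounded_element T) (k + 1) i (r₀ + r₁))
  refine ⟨r₀ + r₁ + r₂, fun w => ?_, fun i => ?_, fun i j => ?_⟩
  · rw [map_add, map_add, hs₁, hs₂, add_zero, add_zero]
    exact hr₀ w
  · rw [map_add, hm₂]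
    ring
  · rw [map_add, map_add, hk₁, hk₂]
    ring

theorem dispRec_spec (v : Dofs 𝓜 k) (T : {T // T ∈ 𝓜.elements}) :
    ∃ h : dispRec v T ∈ vecPoly d (k + 1), IsDispRec T v ⟨dispRec v T, h⟩ := by
  obtain ⟨r, hr⟩ := exists_isDispRec T v
  have hex : ∃ r : E d → E d, r ∈ vecPoly d (k + 1) ∧
      (∀ w ∈ vecPoly d (k + 1),
        ∫ x in T.1, frob (symGrad r x - symGradRec v T x) (symGrad w x) = 0) ∧
      (∀ i, ∫ x in T.1, r x i = ∫ x in T.1, v.elem T x i) ∧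
      ∀ i j, ∫ x in T.1, skewGrad r x i j =
        ∑ F ∈ facesOf 𝓜 T, (∫ x : F.1, (1 / 2 : ℝ) *
          (normal T.1 F.1 i * v.face F x j - v.face F x i * normal T.1 F.1 j)
            ∂(faceMeasure F.1)) :=
    ⟨r.1, r.2, fun w hw => hr.1 ⟨w, hw⟩, hr.2.1,
      fun i j => (hr.2.2 i j).trans (skewFaceLin_apply T i j v)⟩
  have hspec := Classical.epsilon_spec hex
  exact ⟨hspec.1, fun w => hspec.2.1 w.1 w.2, hspec.2.2.1,
    fun i j => (hspec.2.2.2 i j).trans (skewFaceLin_apply T i j v).symm⟩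

/-- The displacement reconstruction as a linear map. -/
def dispRecLin (T : {T // T ∈ 𝓜.elements}) : Dofs 𝓜 k →ₗ[ℝ] vecPoly d (k + 1) where
  toFun v := ⟨dispRec v T, (dispRec_spec v T).choose⟩
  map_add' v w := (dispRec_spec _ T).choose_spec.unique
    ((dispRec_spec v T).choose_spec.add (dispRec_spec w T).choose_spec)
  map_smul' c v := (dispRec_spec _ T).choose_spec.unique ((dispRec_spec v T).choose_spec.smul c)

theorem isDispRec_dispRecLin (T : {T // T ∈ 𝓜.elements}) (v : Dofs 𝓜 k) :
    IsDispRec T v (dispRecLin T v) := (dispRec_spec v T).choose_spec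

end

section

variable {d : ℕ} {Ω : Set (E d)} {𝓜 : PolytopalMesh Ω} {k : ℕ}

/-! ### The stabilisation -/

theorem l2Proj_face_eq (F : {F // F ∈ 𝓜.faces}) {w p : F.1 → E d} (hw : Continuous w)
    (hp : IsL2Proj (faceMeasure F.1) (facePoly k F.1) w p) :
    l2Proj (faceMeasure F.1) (facePoly k F.1) w = p :=
  l2Proj_eq (fun _ hg => 𝓜.integrable_face F.2 hg) (fun _ hp => continuous_of_mem_facePoly hp)
    (fun _ hp => 𝓜.eq_zero_of_integral_inner_face F.2 hp) hw hp

theorem isL2Proj_face (F : {F // F ∈ 𝓜.faces}) {w : F.1 → E d} (hw : Continuous w) :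
    IsL2Proj (faceMeasure F.1) (facePoly k F.1) w
      (l2Proj (faceMeasure F.1) (facePoly k F.1) w) :=
  isL2Proj_l2Proj (fun _ hg => 𝓜.integrable_face F.2 hg)
    (fun _ hp => continuous_of_mem_facePoly hp)
    (fun _ hp => 𝓜.eq_zero_of_integral_inner_face F.2 hp) hw

theorem l2Proj_element_eq (T : {T // T ∈ 𝓜.elements}) {w p : E d → E d} (hw : Continuous w)
    (hp : IsL2Proj (volume.restrict T.1) (vecPoly d k) w p) :
    l2Proj (volume.restrict T.1) (vecPoly d k) w = p :=
  l2Proj_eq (fun _ hg => integrableOn_of_continuous (isBounded_element T) hg)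
    (fun _ hp => continuous_of_mem_vecPoly hp)
    (fun _ hp => eq_zero_of_integral_inner_element (isOpen_element T) (isBounded_element T)
      (nonempty_element T) hp) hw hp

theorem isL2Proj_element (T : {T // T ∈ 𝓜.elements}) {w : E d → E d} (hw : Continuous w) :
    IsL2Proj (volume.restrict T.1) (vecPoly d k) w
      (l2Proj (volume.restrict T.1) (vecPoly d k) w) :=
  isL2Proj_l2Proj (fun _ hg => integrableOn_of_continuous (isBounded_element T) hg)
    (fun _ hp => continuous_of_mem_vecPoly hp)
    (fun _ hp => eq_zero_of_integral_inner_element (isOpen_element T) (isBounded_element T)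
      (nonempty_element T) hp) hw

theorem continuous_dispRec (v : Dofs 𝓜 k) (T : {T // T ∈ 𝓜.elements}) :
    Continuous (dispRec v T) :=
  continuous_of_mem_vecPoly (dispRecLin T v).2

theorem continuous_dispRec_sub_face (v : Dofs 𝓜 k) (T : {T // T ∈ 𝓜.elements})
    (F : {F // F ∈ 𝓜.faces}) : Continuous fun y : F.1 => dispRec v T y - v.face F y :=
  ((continuous_dispRec v T).comp continuous_subtype_val).sub (v.continuous_face F)

theorem continuous_dispRec_sub_elem (v : Dofs 𝓜 k) (T : {T // T ∈ 𝓜.elements}) :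
    Continuous fun y => dispRec v T y - v.elem T y :=
  (continuous_dispRec v T).sub (v.continuous_elem T)

theorem dispRec_add (v w : Dofs 𝓜 k) (T : {T // T ∈ 𝓜.elements}) :
    dispRec (v + w) T = dispRec v T + dispRec w T :=
  congrArg Subtype.val ((dispRecLin T).map_add v w)

theorem dispRec_smul (c : ℝ) (v : Dofs 𝓜 k) (T : {T // T ∈ 𝓜.elements}) :
    dispRec (c • v) T = c • dispRec v T :=
  congrArg Subtype.val ((dispRecLin T).map_smul c v)

/-- The face residual as a linear map. -/
def residualLin (T : {T // T ∈ 𝓜.elements}) (F : {F // F ∈ 𝓜.faces}) :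
    Dofs 𝓜 k →ₗ[ℝ] F.1 → E d where
  toFun v := residual v T F
  map_add' v w := by
    have h1 : (fun y : F.1 => dispRec (v + w) T y - (v + w).face F y)
        = (fun y : F.1 => dispRec v T y - v.face F y) +
          fun y : F.1 => dispRec w T y - w.face F y := by
      funext y
      rw [dispRec_add]
      exact add_sub_add_comm _ _ _ _
    have h2 : (fun y => dispRec (v + w) T y - (v + w).elem T y)
        = (fun y => dispRec v T y - v.elem T y) + fun y => dispRec w T y - w.elem T y := by
      funext y
      rw [dispRec_add]
      exact add_sub_add_comm _ _ _ _
    funext x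
    simp only [residual, Pi.add_apply]
    rw [h1, h2, l2Proj_face_eq F ((continuous_dispRec_sub_face v T F).add
        (continuous_dispRec_sub_face w T F))
      ((isL2Proj_face F (continuous_dispRec_sub_face v T F)).add
        (fun _ hg => 𝓜.integrable_face F.2 hg) (fun _ hp => continuous_of_mem_facePoly hp)
        (continuous_dispRec_sub_face v T F) (continuous_dispRec_sub_face w T F)
        (isL2Proj_face F (continuous_dispRec_sub_face w T F))),
      l2Proj_element_eq T ((continuous_dispRec_sub_elem v T).add (continuous_dispRec_sub_elem w T))
      ((isL2Proj_element T (continuous_dispRec_sub_elem v T)).add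
        (fun _ hg => integrableOn_of_continuous (isBounded_element T) hg)
        (fun _ hp => continuous_of_mem_vecPoly hp)
        (continuous_dispRec_sub_elem v T) (continuous_dispRec_sub_elem w T)
        (isL2Proj_element T (continuous_dispRec_sub_elem w T)))]
    exact add_sub_add_comm _ _ _ _
  map_smul' c v := by
    have h1 : (fun y : F.1 => dispRec (c • v) T y - (c • v).face F y)
        = c • (fun y : F.1 => dispRec v T y - v.face F y) := by
      funext y
      rw [dispRec_smul]
      exact (smul_sub c (dispRec v T y) (v.face F y)).symm
    have h2 : (fun y => dispRec (c • v) T y - (c • v).elem T y)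
        = c • (fun y => dispRec v T y - v.elem T y) := by
      funext y
      rw [dispRec_smul]
      exact (smul_sub c (dispRec v T y) (v.elem T y)).symm
    funext x
    simp only [residual, Pi.smul_apply, RingHom.id_apply]
    rw [h1, h2, l2Proj_face_eq F ((continuous_dispRec_sub_face v T F).const_smul c)
      ((isL2Proj_face F (continuous_dispRec_sub_face v T F)).smul c),
      l2Proj_element_eq T ((continuous_dispRec_sub_elem v T).const_smul c)
      ((isL2Proj_element T (continuous_dispRec_sub_elem v T)).smul c)]
    exact (smul_sub c (_ : E d) (_ : E d)).symm

theorem residual_mem_facePoly (v : Dofs 𝓜 k) (T : {T // T ∈ 𝓜.elements})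
    (F : {F // F ∈ 𝓜.faces}) : residual v T F ∈ facePoly k F.1 :=
  (facePoly k F.1).sub_mem (isL2Proj_face F (continuous_dispRec_sub_face v T F)).1
    (restrict_mem_facePoly (isL2Proj_element T (continuous_dispRec_sub_elem v T)).1)

theorem continuous_residual (v : Dofs 𝓜 k) (T : {T // T ∈ 𝓜.elements})
    (F : {F // F ∈ 𝓜.faces}) : Continuous (residual v T F) :=
  continuous_of_mem_facePoly (residual_mem_facePoly v T F)

/-- The `L²(F)` inner product of the residuals. -/
def residualForm (T : {T // T ∈ 𝓜.elements}) (F : {F // F ∈ 𝓜.faces}) :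
    Dofs 𝓜 k →ₗ[ℝ] Dofs 𝓜 k →ₗ[ℝ] ℝ :=
  integralBilin (faceMeasure F.1)
    (LinearMap.mk₂ ℝ (fun u v x => (inner ℝ (residualLin T F u x) (residualLin T F v x) : ℝ))
      (fun _ _ _ => funext fun _ => by
        rw [map_add]
        exact inner_add_left _ _ _)
      (fun _ _ _ => funext fun _ => by
        rw [map_smul]
        exact real_inner_smul_left _ _ _)
      (fun _ _ _ => funext fun _ => by
        rw [map_add]
        exact inner_add_right _ _ _)
      (fun _ _ _ => funext fun _ => by
        rw [map_smul]
        exact real_inner_smul_right _ _ _))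
    fun u v => 𝓜.integrable_face F.2
      ((continuous_residual u T F).inner (continuous_residual v T F))

/-- The stabilisation as a bilinear form. -/
def stabForm (γ : ℝ) : Dofs 𝓜 k →ₗ[ℝ] Dofs 𝓜 k →ₗ[ℝ] ℝ :=
  ∑ T : {T // T ∈ 𝓜.elements}, ∑ F ∈ facesOf 𝓜 T, (γ / Metric.diam F.1) • residualForm T F

theorem stabForm_apply (γ : ℝ) (u v : Dofs 𝓜 k) : stabForm γ u v = stab γ u v := by
  simp only [stabForm, stab, stabLocal, LinearMap.sum_apply, LinearMap.smul_apply, smul_eq_mul]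
  rfl

theorem stab_comm (γ : ℝ) (u v : Dofs 𝓜 k) : stab γ u v = stab γ v u := by
  simp only [stab, stabLocal, real_inner_comm]

theorem stabLocal_term_nonneg {γ : ℝ} (hγ : 0 < γ) (u : Dofs 𝓜 k) (T : {T // T ∈ 𝓜.elements})
    (F : {F // F ∈ 𝓜.faces}) : 0 ≤ γ / Metric.diam F.1 *
      ∫ x : F.1, (inner ℝ (residual u T F x) (residual u T F x) : ℝ) ∂(faceMeasure F.1) :=
  mul_nonneg (div_nonneg hγ.le Metric.diam_nonneg)
    (integral_nonneg fun _ => real_inner_self_nonneg)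

theorem stab_self_nonneg {γ : ℝ} (hγ : 0 < γ) (u : Dofs 𝓜 k) : 0 ≤ stab γ u u :=
  Finset.sum_nonneg fun T _ => Finset.sum_nonneg fun F _ => stabLocal_term_nonneg hγ u T F

/-- A vanishing sum of nonnegative terms with positive weights γ / h_F; the residual is a face
polynomial, so its zero L² norm makes it vanish pointwise. -/
theorem residual_eq_zero_of_stab (hd : 2 ≤ d) {γ : ℝ} (hγ : 0 < γ) {u : Dofs 𝓜 k}
    (h : stab γ u u = 0) (T : {T // T ∈ 𝓜.elements}) {F : {F // F ∈ 𝓜.faces}}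
    (hF : F ∈ facesOf 𝓜 T) : residual u T F = 0 := by
  have h1 := (Finset.sum_eq_zero_iff_of_nonneg fun T _ => Finset.sum_nonneg fun F _ =>
    stabLocal_term_nonneg hγ u T F).1 h T (Finset.mem_univ T)
  have h2 := (Finset.sum_eq_zero_iff_of_nonneg fun F _ => stabLocal_term_nonneg hγ u T F).1 h1 F hF
  have hdiam : 0 < Metric.diam F.1 :=
    diam_pos_of_surface_pos hd (𝓜.face_isCompact F.2).isBounded (𝓜.face_pos F.1 F.2)
  exact 𝓜.eq_zero_of_integral_inner_face F.2 (residual_mem_facePoly u T F)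
    ((mul_eq_zero.1 h2).resolve_left (div_pos hγ hdiam).ne')

/-! ### Definiteness -/

theorem mem_facesOf {T : {T // T ∈ 𝓜.elements}} {F : {F // F ∈ 𝓜.faces}} :
    F ∈ facesOf 𝓜 T ↔ F.1 ⊆ frontier T.1 := by
  simp [facesOf]

/-- If the symmetric gradient reconstruction and the residuals vanish, the element component of the
degrees of freedom is a rigid motion that agrees with the face components. -/
theorem face_eq_elem_and_isRigid (hk : 1 ≤ k) {v : Dofs 𝓜 k} {T : {T // T ∈ 𝓜.elements}}
    (hG : symGradRecLin T v = 0) (hres : ∀ F ∈ facesOf 𝓜 T, residual v T F = 0) :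
    (∀ F ∈ facesOf 𝓜 T, ∀ x : F.1, v.face F x = v.elem T x) ∧ IsRigid (v.elem T) := by
  have hr := isDispRec_dispRecLin T v
  -- The strain identity for r_T v, tested with r_T v itself.
  have hS : symGradLin d (k + 1) (dispRecLin T v) = 0 := by
    refine frobForm_definite T _ ?_
    have := hr.1 (dispRecLin T v)
    rwa [hG, map_zero, sub_zero] at this
  have hrig : IsRigid (dispRec v T) := isRigid_of_symGrad_eq_zero (dispRecLin T v).2
    fun x => congrFun (congrArg Subtype.val hS) x
  -- A priori of degree k + 1, r_T v is affine. Both projections in the residual then act on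
  -- polynomials of degree k, r_T v cancels, and v_T - v_F remains.
  have hmem : dispRec v T ∈ vecPoly d k := hrig.mem_vecPoly hk
  have hface : ∀ F ∈ facesOf 𝓜 T, ∀ x : F.1, v.face F x = v.elem T x := by
    intro F hF x
    have h := congrFun (hres F hF) x
    have hm1 : (fun y : F.1 => dispRec v T y - v.face F y) ∈ facePoly k F.1 :=
      (facePoly k F.1).sub_mem (restrict_mem_facePoly hmem) (v.2 F).2
    have hm2 : (fun y => dispRec v T y - v.elem T y) ∈ vecPoly d k :=
      (vecPoly d k).sub_mem hmem (v.1 T).2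
    simp only [residual] at h
    rw [l2Proj_face_eq F (continuous_dispRec_sub_face v T F) (isL2Proj_self hm1),
      l2Proj_element_eq T (continuous_dispRec_sub_elem v T) (isL2Proj_self hm2)] at h
    rw [sub_sub_sub_cancel_left] at h
    exact (sub_eq_zero.1 h).symm
  refine ⟨hface, isRigid_of_symGrad_eq_zero (v.1 T).2 fun x => ?_⟩
  -- With v_F = v_T the face terms in the definition of G_T v vanish; the choice τ = ∇ₛ v_T
  -- finishes.
  have hSv : symGradLin d k (v.1 T) = 0 := by
    refine frobForm_definite T _ ?_
    have h := frobForm_symGradRecLin T v (symGradLin d k (v.1 T))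
    rw [hG, map_zero, LinearMap.zero_apply, gradRhs_apply, Finset.sum_eq_zero, add_zero] at h
    · exact h.symm
    · intro F hF
      rw [← integral_zero]
      refine integral_congr_ae (Eventually.of_forall fun x => ?_)
      simp [hface F hF x]
  exact congrFun (congrArg Subtype.val hSv) x

/-- The discrete Korn inequality in qualitative form. -/
theorem eq_zero_of_symGradRec_of_stab (hd : 2 ≤ d) (hk : 1 ≤ k) {γ : ℝ} (hγ : 0 < γ)
    {v : Dofs 𝓜 k} (hv : v ∈ Dofs0 𝓜 k) (hG : ∀ T, symGradRecLin T v = 0)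
    (hs : stab γ v v = 0) : v = 0 := by
  have hloc := fun T => face_eq_elem_and_isRigid hk (hG T)
    fun F hF => residual_eq_zero_of_stab hd hγ hs T hF
  have hzero : ∀ (T : {T // T ∈ 𝓜.elements}) (F : {F // F ∈ 𝓜.faces}), F.1 ⊆ frontier T.1 →
      (∀ x, v.face F x = 0) → v.elem T = 0 := by
    intro T F hF h0
    obtain ⟨A, hA, hFA⟩ := 𝓜.face_hyperplanar F.1 F.2
    refine (hloc T).2.eq_zero_of_hyperplane hA (𝓜.eq_zero_of_ae_face F.2 hA hFA (v.1 T).2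
      (Eventually.of_forall fun x => ?_))
    exact ((hloc T).1 F (mem_facesOf.2 hF) x).symm.trans (h0 x)
  -- Membership is quantified a second time because the propagated property is a predicate on bare
  -- sets, whereas `v.elem` takes an element of the mesh.
  have hall : ∀ T ∈ 𝓜.elements, ∀ hT : T ∈ 𝓜.elements, v.elem ⟨T, hT⟩ = 0 := by
    refine 𝓜.forall_of_propagate (by omega) (fun T => ∀ hT : T ∈ 𝓜.elements, v.elem ⟨T, hT⟩ = 0)
      ?_ ?_
    · intro T _ F hF hFT hb hT
      refine hzero ⟨T, hT⟩ ⟨F, hF⟩ hFT fun x => ?_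
      have : v.2 ⟨F, hF⟩ = 0 := hv ⟨F, hF⟩ hb
      exact congrFun (congrArg Subtype.val this) x
    · intro T₁ hT₁ T₂ _ F hF hF₁ hF₂ h₁ hT₂
      refine hzero ⟨T₂, hT₂⟩ ⟨F, hF⟩ hF₂ fun x => ?_
      rw [(hloc ⟨T₁, hT₁⟩).1 ⟨F, hF⟩ (mem_facesOf.2 hF₁) x, h₁ hT₁]
      rfl
  refine Prod.ext (funext fun T => Subtype.ext (hall T.1 T.2 T.2)) (funext fun F => ?_)
  refine Subtype.ext (funext fun x => ?_)
  obtain ⟨T, hT, hFT⟩ : ∃ T ∈ 𝓜.elements, F.1 ⊆ frontier T := by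
    rcases 𝓜.face_cases F.1 F.2 with ⟨T, hT, _, _, _, h⟩ | ⟨T, hT, h⟩
    · exact ⟨T, hT, h.trans inter_subset_left⟩
    · exact ⟨T, hT, h.trans inter_subset_left⟩
  have h := (hloc ⟨T, hT⟩).1 F (mem_facesOf.2 hFT) x
  rw [hall T hT hT] at h
  exact h

end

section

/-! ### Superposition operators -/

theorem abs_frob_le {d : ℕ} (a b : Mat d) : |frob a b| ≤ frob a a + frob b b := by
  unfold frob
  rw [← Finset.sum_add_distrib]
  refine (Finset.abs_sum_le_sum_abs _ _).trans (Finset.sum_le_sum fun i _ => ?_)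
  rw [← Finset.sum_add_distrib]
  refine (Finset.abs_sum_le_sum_abs _ _).trans (Finset.sum_le_sum fun j _ => ?_)
  rw [abs_le]
  constructor <;> nlinarith [sq_nonneg (a i j + b i j), sq_nonneg (a i j - b i j),
    mul_self_nonneg (a i j), mul_self_nonneg (b i j)]

theorem frob_add_self_le {d : ℕ} (a b : Mat d) :
    frob (a + b) (a + b) ≤ 2 * frob a a + 2 * frob b b := by
  have h := frob_self_nonneg (a - b)
  have e1 : frob (a + b) (a + b) = frob a a + 2 * frob a b + frob b b := by
    rw [frob_add_left, frob_add_right, frob_add_right, frob_comm b a]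
    ring
  have e2 : frob (a - b) (a - b) = frob a a - 2 * frob a b + frob b b := by
    rw [frob_sub_left, frob_sub_right, frob_sub_right, frob_comm b a]
    ring
  linarith

/-- With a = σ(x, τ) and b = σ(x, 0), this turns the linear growth of σ into an integrable majorant
of its square. -/
theorem frob_stress_le {d : ℕ} {s : ℝ} {τ a b : Mat d}
    (h : frobNorm (a - b) ≤ s * frobNorm τ) :
    frob a a ≤ 2 * frob b b + 2 * (s ^ 2 * frob τ τ) := by
  have h1 : frob (a - b) (a - b) ≤ s ^ 2 * frob τ τ := by
    rw [← frobNorm_sq, ← frobNorm_sq, ← mul_pow]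
    exact pow_le_pow_left₀ (Real.sqrt_nonneg _) h 2
  have h2 := frob_add_self_le b (a - b)
  rw [add_sub_cancel] at h2
  linarith

theorem integrable_frob_of_memLp {d : ℕ} {μ : Measure (E d)} {f g : E d → Mat d}
    (hf : ∀ i j, MemLp (fun x => f x i j) 2 μ) (hg : ∀ i j, MemLp (fun x => g x i j) 2 μ) :
    Integrable (fun x => frob (f x) (g x)) μ :=
  integrable_finsetSum _ fun i _ => integrable_finsetSum _ fun j _ =>
    (hf i j).integrable_mul (hg i j)

theorem aestronglyMeasurable_frob {d : ℕ} {μ : Measure (E d)} {f g : E d → Mat d}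
    (hf : ∀ i j, AEStronglyMeasurable (fun x => f x i j) μ)
    (hg : ∀ i j, AEStronglyMeasurable (fun x => g x i j) μ) :
    AEStronglyMeasurable (fun x => frob (f x) (g x)) μ :=
  Finset.aestronglyMeasurable_fun_sum _ fun i _ => Finset.aestronglyMeasurable_fun_sum _ fun j _ =>
    (hf i j).mul (hg i j)

/-- The symmetric part of a matrix. -/
def symPart {d : ℕ} (M : Fin d → Fin d → ℝ) : Mat d := fun i j => (1 / 2 : ℝ) * (M i j + M j i)

theorem isSymm_symPart {d : ℕ} (M : Fin d → Fin d → ℝ) : (symPart M).IsSymm := by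
  ext i j
  simp [symPart, add_comm]

theorem symPart_eq_self {d : ℕ} {M : Mat d} (h : M.IsSymm) : symPart M = M := by
  ext i j
  have : M j i = M i j := h.apply i j
  simp only [symPart, this]
  ring

theorem continuous_symPart {d : ℕ} : Continuous (symPart : (Fin d → Fin d → ℝ) → Mat d) :=
  continuous_pi fun i => continuous_pi fun j => by
    simp only [symPart]
    fun_prop

/-- Measurability of the superposition operator of a Carathéodory function. -/
theorem aestronglyMeasurable_superposition {d : ℕ} {μ : Measure (E d)}
    {σ : E d → Mat d → Mat d} (hc : ∀ᵐ x ∂μ, ContinuousOn (σ x) {τ | τ.IsSymm})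
    (hm : ∀ τ : Mat d, τ.IsSymm → ∀ i j, AEStronglyMeasurable (fun x => σ x τ i j) μ)
    {G : E d → Mat d} (hG : ∀ i j, Measurable fun x => G x i j) (hs : ∀ x, (G x).IsSymm)
    (i j : Fin d) : AEStronglyMeasurable (fun x => σ x (G x) i j) μ := by
  have hGm : StronglyMeasurable (fun x => (G x : Fin d → Fin d → ℝ)) :=
    (measurable_pi_lambda _ fun i => measurable_pi_lambda _ fun j => hG i j).stronglyMeasurable
  let s : ℕ → SimpleFunc (E d) (Fin d → Fin d → ℝ) := hGm.approx
  -- The simple functions approximating `G` need not be symmetric; `symPart` moves them to where σ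
  -- is continuous and measurable, and fixes the limit. On each fibre the second argument of σ is
  -- constant.
  refine aestronglyMeasurable_of_tendsto_ae atTop (f := fun n x => σ x (symPart (s n x)) i j)
    (fun n => ?_) ?_
  · have heq : (fun x => σ x (symPart (s n x)) i j) = fun x => ∑ y ∈ (s n).range,
        ((s n) ⁻¹' {y}).indicator (fun x => σ x (symPart y) i j) x := by
      funext x
      rw [Finset.sum_eq_single (s n x)]
      · rw [indicator_of_mem (by simp)]
      · intro y _ hy
        rw [indicator_of_notMem]
        simpa using hy.symm
      · intro h
        exact absurd (SimpleFunc.mem_range_self (s n) x) h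
    rw [heq]
    exact Finset.aestronglyMeasurable_fun_sum _ fun y _ =>
      (hm _ (isSymm_symPart y) i j).indicator ((s n).measurableSet_fiber y)
  · filter_upwards [hc] with x hx
    have h1 : Tendsto (fun n => symPart (s n x)) atTop (𝓝[{τ | τ.IsSymm}] (G x)) := by
      refine tendsto_nhdsWithin_iff.2 ⟨?_, Eventually.of_forall fun n => isSymm_symPart _⟩
      have := (continuous_symPart.tendsto (G x)).comp (hGm.tendsto_approx x)
      rwa [symPart_eq_self (hs x)] at this
    have h2 := (hx (G x) (hs x)).tendsto.comp h1
    exact ((continuous_apply j).tendsto _).comp (((continuous_apply i).tendsto _).comp h2)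

/-! ### Strain fields and integrals of the stress. -/

section Consistency

variable {d : ℕ} {Ω : Set (E d)} {σ : E d → Mat d → Mat d}

/-- Admissible strain fields: measurable, symmetric and square integrable. -/
structure IsStrain (Ω : Set (E d)) (G : E d → Mat d) : Prop where
  measurable : ∀ i j, Measurable fun x => G x i j
  symm : ∀ x, (G x).IsSymm
  memLp : ∀ i j, MemLp (fun x => G x i j) 2 (volume.restrict Ω)

theorem IsStrain.add {G H : E d → Mat d} (hG : IsStrain Ω G) (hH : IsStrain Ω H) :
    IsStrain Ω (G + H) :=
  ⟨fun i j => (hG.measurable i j).add (hH.measurable i j), fun x => (hG.symm x).add (hH.symm x),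
    fun i j => (hG.memLp i j).add (hH.memLp i j)⟩

theorem IsStrain.smul {G : E d → Mat d} (hG : IsStrain Ω G) (c : ℝ) : IsStrain Ω (c • G) :=
  ⟨fun i j => (hG.measurable i j).const_mul c, fun x => (hG.symm x).smul c,
    fun i j => (hG.memLp i j).const_mul c⟩

theorem IsStrain.integrable_frob {G H : E d → Mat d} (hG : IsStrain Ω G) (hH : IsStrain Ω H) :
    Integrable (fun x => frob (G x) (H x)) (volume.restrict Ω) :=
  integrable_frob_of_memLp hG.memLp hH.memLp

theorem StressAssumption.aestronglyMeasurable_frob (hσ : StressAssumption Ω σ) {G H : E d → Mat d}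
    (hG : IsStrain Ω G) (hH : IsStrain Ω H) :
    AEStronglyMeasurable (fun x => frob (σ x (G x)) (H x)) (volume.restrict Ω) :=
  HHO.aestronglyMeasurable_frob
    (aestronglyMeasurable_superposition hσ.continuous hσ.measurable hG.measurable hG.symm)
    fun i j => (hH.memLp i j).aestronglyMeasurable

theorem StressAssumption.integrable_frob (hσ : StressAssumption Ω σ) {G H : E d → Mat d}
    (hG : IsStrain Ω G) (hH : IsStrain Ω H) :
    Integrable (fun x => frob (σ x (G x)) (H x)) (volume.restrict Ω) := by
  obtain ⟨s, _, _, _, hb⟩ := hσ.bounds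
  refine Integrable.mono' ((((integrable_frob_of_memLp hσ.memLp_zero hσ.memLp_zero).const_mul
    2).add (((hG.integrable_frob hG).const_mul (s ^ 2)).const_mul 2)).add (hH.integrable_frob hH))
    (hσ.aestronglyMeasurable_frob hG hH) ?_
  filter_upwards [hb] with x hx
  have h1 := frob_stress_le (hx (G x) (hG.symm x) 0 Matrix.isSymm_zero).1
  have h2 := abs_frob_le (σ x (G x)) (H x)
  simp only [Pi.add_apply, Real.norm_eq_abs]
  linarith

/-- Dominated convergence: σ(x, ·) is continuous on symmetric matrices, and its linear growth gives
a majorant uniform in t ∈ (0, 1). This is the continuity along rays that Minty's theorem asks for.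
-/
theorem StressAssumption.tendsto_integral (hσ : StressAssumption Ω σ) {G H K : E d → Mat d}
    (hG : IsStrain Ω G) (hH : IsStrain Ω H) (hK : IsStrain Ω K) :
    Tendsto (fun t : ℝ => ∫ x in Ω, frob (σ x ((G + t • H) x)) (K x)) (𝓝[>] 0)
      (𝓝 (∫ x in Ω, frob (σ x (G x)) (K x))) := by
  obtain ⟨s, _, _, _, hb⟩ := hσ.bounds
  refine tendsto_integral_filter_of_dominated_convergence
    (fun x => 2 * frob (σ x 0) (σ x 0) + 2 * (s ^ 2 * (2 * frob (G x) (G x) + 2 * frob (H x) (H x)))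
      + frob (K x) (K x))
    (Eventually.of_forall fun t => hσ.aestronglyMeasurable_frob (hG.add (hH.smul t)) hK) ?_ ?_ ?_
  · filter_upwards [Ioo_mem_nhdsGT (zero_lt_one : (0 : ℝ) < 1)] with t ht
    filter_upwards [hb] with x hx
    have hs := (hG.add (hH.smul t)).symm x
    have h1 := frob_stress_le (hx _ hs 0 Matrix.isSymm_zero).1
    have h2 := abs_frob_le (σ x ((G + t • H) x)) (K x)
    have h3 := frob_add_self_le (G x) (t • H x)
    rw [frob_smul_left, frob_smul_right, ← mul_assoc] at h3
    have h4 : t * t * frob (H x) (H x) ≤ frob (H x) (H x) :=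
      mul_le_of_le_one_left (frob_self_nonneg _) (by nlinarith [ht.1, ht.2])
    have h5 : s ^ 2 * frob ((G + t • H) x) ((G + t • H) x)
        ≤ s ^ 2 * (2 * frob (G x) (G x) + 2 * frob (H x) (H x)) := by
      refine mul_le_mul_of_nonneg_left ?_ (sq_nonneg s)
      simp only [Pi.add_apply, Pi.smul_apply]
      linarith
    rw [Real.norm_eq_abs]
    linarith
  · exact (((integrable_frob_of_memLp hσ.memLp_zero hσ.memLp_zero).const_mul 2).add
      (((((hG.integrable_frob hG).const_mul 2).add ((hH.integrable_frob hH).const_mul 2)).const_mul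
        (s ^ 2)).const_mul 2)).add (hK.integrable_frob hK)
  · filter_upwards [hσ.continuous] with x hx
    have h1 : Tendsto (fun t : ℝ => (G + t • H) x) (𝓝[>] 0) (𝓝[{τ | τ.IsSymm}] (G x)) := by
      refine tendsto_nhdsWithin_iff.2
        ⟨?_, Eventually.of_forall fun t => (hG.add (hH.smul t)).symm x⟩
      have : Continuous fun t : ℝ => G x + t • H x := by fun_prop
      simpa using (this.tendsto 0).mono_left (nhdsWithin_le_nhds (s := Ioi 0))
    have h2 := (hx (G x) (hG.symm x)).tendsto.comp h1
    have h3 : Continuous fun A : Mat d => frob A (K x) := continuous_frob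
      (fun i j => (continuous_apply j).comp (continuous_apply i)) fun i j => continuous_const
    exact (h3.tendsto _).comp h2

end Consistency

/-! ### Global fields -/

variable {d : ℕ} {Ω : Set (E d)} {𝓜 : PolytopalMesh Ω} {k : ℕ}

theorem globalSymGradRec_apply (v : Dofs 𝓜 k) (x : E d) (i j : Fin d) :
    globalSymGradRec v x i j = ∑ T : {T // T ∈ 𝓜.elements},
      T.1.indicator (fun x => symGradRec v T x i j) x := by
  simp only [globalSymGradRec, Matrix.sum_apply]
  refine Finset.sum_congr rfl fun T _ => ?_
  by_cases h : x ∈ T.1 <;> simp [h]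

theorem broken_apply (v : Dofs 𝓜 k) (x : E d) (i : Fin d) :
    broken v x i = ∑ T : {T // T ∈ 𝓜.elements}, T.1.indicator (fun x => v.elem T x i) x := by
  rw [← coordCLM_apply i (broken v x), broken, map_sum]
  refine Finset.sum_congr rfl fun T _ => ?_
  by_cases h : x ∈ T.1 <;> simp [h]

theorem memLp_sum_indicator (g : {T // T ∈ 𝓜.elements} → E d → ℝ) (hg : ∀ T, Continuous (g T)) :
    MemLp (fun x => ∑ T : {T // T ∈ 𝓜.elements}, T.1.indicator (g T) x) 2
      (volume.restrict Ω) := by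
  refine memLp_finsetSum _ fun T _ => MemLp.restrict _ ?_
  rw [memLp_indicator_iff_restrict (isOpen_element T).measurableSet,
    memLp_two_iff_integrable_sq (hg T).aestronglyMeasurable]
  exact integrableOn_of_continuous (isBounded_element T) ((hg T).pow 2)

theorem continuous_symGradRec_entry (v : Dofs 𝓜 k) (T : {T // T ∈ 𝓜.elements}) (i j : Fin d) :
    Continuous fun x => symGradRec v T x i j :=
  continuous_entry_of_mem_symPoly (symGradRecLin T v).2 i j

theorem isStrain_globalSymGradRec (v : Dofs 𝓜 k) : IsStrain Ω (globalSymGradRec v) where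
  measurable i j := by
    simp only [globalSymGradRec_apply]
    exact Finset.measurable_fun_sum _ fun T _ =>
      (continuous_symGradRec_entry v T i j).measurable.indicator (isOpen_element T).measurableSet
  symm x := by
    ext i j
    rw [Matrix.transpose_apply, globalSymGradRec_apply, globalSymGradRec_apply]
    refine Finset.sum_congr rfl fun T _ => ?_
    congr 1
    funext y
    exact ((symGradRecLin T v).2.2 y).apply i j
  memLp i j := by
    simp only [globalSymGradRec_apply]
    exact memLp_sum_indicator _ fun T => continuous_symGradRec_entry v T i j

theorem globalSymGradRec_add (v w : Dofs 𝓜 k) :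
    globalSymGradRec (v + w) = globalSymGradRec v + globalSymGradRec w := by
  funext x
  simp only [globalSymGradRec, Pi.add_apply]
  rw [← Finset.sum_add_distrib]
  refine Finset.sum_congr rfl fun T _ => ?_
  have : symGradRec (v + w) T = symGradRec v T + symGradRec w T :=
    congrArg Subtype.val ((symGradRecLin T).map_add v w)
  rw [this]
  exact congrFun (indicator_add T.1 _ _) x

theorem globalSymGradRec_smul (c : ℝ) (v : Dofs 𝓜 k) :
    globalSymGradRec (c • v) = c • globalSymGradRec v := by
  funext x
  simp only [globalSymGradRec, Pi.smul_apply]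
  rw [Finset.smul_sum]
  refine Finset.sum_congr rfl fun T _ => ?_
  have : symGradRec (c • v) T = c • symGradRec v T :=
    congrArg Subtype.val ((symGradRecLin T).map_smul c v)
  rw [this]
  exact congrFun (indicator_const_smul T.1 c _) x

theorem broken_add (v w : Dofs 𝓜 k) (x : E d) : broken (v + w) x = broken v x + broken w x := by
  simp only [broken]
  rw [← Finset.sum_add_distrib]
  exact Finset.sum_congr rfl fun T _ => congrFun (indicator_add T.1 (v.elem T) (w.elem T)) x

theorem broken_smul (c : ℝ) (v : Dofs 𝓜 k) (x : E d) : broken (c • v) x = c • broken v x := by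
  simp only [broken]
  rw [Finset.smul_sum]
  exact Finset.sum_congr rfl fun T _ => congrFun (indicator_const_smul T.1 c (v.elem T)) x

theorem integrable_inner_broken {f : E d → E d} (hf : MemLp f 2 (volume.restrict Ω))
    (v : Dofs 𝓜 k) :
    Integrable (fun x => (inner ℝ (f x) (broken v x) : ℝ)) (volume.restrict Ω) := by
  simp only [inner_eq_sum]
  refine integrable_finsetSum _ fun i _ => MemLp.integrable_mul (p := 2) (q := 2) ?_ ?_
  · exact (coordCLM i).comp_memLp' hf
  · simp only [broken_apply]
    exact memLp_sum_indicator _ fun T => (coordCLM i).continuous.comp (v.continuous_elem T)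

/-- An element is an open subset of the closure of Ω, and Ω has no slits. Statements a.e. in Ω thus
restrict to elements. -/
theorem PolytopalMesh.element_subset (hΩ : interior (closure Ω) = Ω)
    (T : {T // T ∈ 𝓜.elements}) : T.1 ⊆ Ω := by
  refine (interior_maximal ?_ (isOpen_element T)).trans hΩ.subset
  rw [𝓜.closure_eq]
  exact subset_closure.trans (subset_biUnion_of_mem (u := fun T => closure T) T.2)

theorem globalSymGradRec_eq_of_mem (v : Dofs 𝓜 k) {T : {T // T ∈ 𝓜.elements}} {x : E d}
    (hx : x ∈ T.1) : globalSymGradRec v x = symGradRec v T x := by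
  rw [globalSymGradRec, Finset.sum_eq_single T]
  · rw [indicator_of_mem hx]
  · intro T' _ hne
    refine indicator_of_notMem (fun hx' => ?_) _
    exact Set.disjoint_left.1 (𝓜.element_disjoint T'.1 T'.2 T.1 T.2
      fun h => hne (Subtype.ext h)) hx' hx
  · intro h
    exact absurd (Finset.mem_univ T) h

theorem symGradRecLin_eq_zero_of_ae (hΩ : interior (closure Ω) = Ω) {v : Dofs 𝓜 k}
    (h : ∀ᵐ x ∂(volume.restrict Ω), globalSymGradRec v x = 0) (T : {T // T ∈ 𝓜.elements}) :
    symGradRecLin T v = 0 := by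
  refine frobForm_definite T _ ?_
  rw [frobForm_apply, ← integral_zero]
  refine integral_congr_ae ?_
  have h1 := ae_restrict_of_ae_restrict_of_subset (𝓜.element_subset hΩ T) h
  filter_upwards [h1, ae_restrict_mem (isOpen_element T).measurableSet] with x hx hxT
  rw [globalSymGradRec_eq_of_mem v hxT] at hx
  change frob (symGradRec v T x) (symGradRec v T x) = 0
  rw [hx, frob_zero_left]

end

section

theorem StressAssumption.integrable_frob_sub {d : ℕ} {Ω : Set (E d)} {σ : E d → Mat d → Mat d}
    (hσ : StressAssumption Ω σ) {G H : E d → Mat d} (hG : IsStrain Ω G) (hH : IsStrain Ω H) :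
    Integrable (fun x => frob (σ x (G x) - σ x (H x)) (G x - H x)) (volume.restrict Ω) := by
  refine (((hσ.integrable_frob hG hG).sub (hσ.integrable_frob hG hH)).sub
    ((hσ.integrable_frob hH hG).sub (hσ.integrable_frob hH hH))).congr
    (Eventually.of_forall fun x => ?_)
  simp only [frob_sub_left, frob_sub_right, Pi.sub_apply]
  ring

/-! ### The discrete problem -/

variable {d : ℕ} {Ω : Set (E d)} {𝓜 : PolytopalMesh Ω} {k : ℕ} {σ : E d → Mat d → Mat d}

/-- The consistency contribution as a linear functional of the test function. -/
def consistencyLin (hσ : StressAssumption Ω σ) (u : Dofs 𝓜 k) : Dofs 𝓜 k →ₗ[ℝ] ℝ :=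
  integralLin (volume.restrict Ω)
    { toFun := fun v x => frob (σ x (globalSymGradRec u x)) (globalSymGradRec v x)
      map_add' := fun v w => funext fun x => by
        rw [globalSymGradRec_add]
        exact frob_add_right _ _ _
      map_smul' := fun c v => funext fun x => by
        rw [globalSymGradRec_smul]
        exact frob_smul_right _ _ _ }
    fun v => hσ.integrable_frob (isStrain_globalSymGradRec u) (isStrain_globalSymGradRec v)

theorem consistencyLin_apply (hσ : StressAssumption Ω σ) (u v : Dofs 𝓜 k) :
    consistencyLin hσ u v = consistency σ u v := rfl

/-- The load functional. -/
def loadLin (𝓜 : PolytopalMesh Ω) (k : ℕ) {f : E d → E d} (hf : MemLp f 2 (volume.restrict Ω)) :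
    Dofs 𝓜 k →ₗ[ℝ] ℝ :=
  integralLin (volume.restrict Ω)
    { toFun := fun v x => (inner ℝ (f x) (broken v x) : ℝ)
      map_add' := fun v w => funext fun x => by
        rw [broken_add]
        exact inner_add_right _ _ _
      map_smul' := fun c v => funext fun x => by
        rw [broken_smul]
        exact real_inner_smul_right _ _ _ }
    fun v => integrable_inner_broken hf v

/-- The inner product of the reconstructed strains. -/
def strainForm (𝓜 : PolytopalMesh Ω) (k : ℕ) : Dofs 𝓜 k →ₗ[ℝ] Dofs 𝓜 k →ₗ[ℝ] ℝ :=
  integralBilin (volume.restrict Ω)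
    (LinearMap.mk₂ ℝ (fun u v x => frob (globalSymGradRec u x) (globalSymGradRec v x))
      (fun _ _ _ => funext fun _ => by
        rw [globalSymGradRec_add]
        exact frob_add_left _ _ _)
      (fun _ _ _ => funext fun _ => by
        rw [globalSymGradRec_smul]
        exact frob_smul_left _ _ _)
      (fun _ _ _ => funext fun _ => by
        rw [globalSymGradRec_add]
        exact frob_add_right _ _ _)
      (fun _ _ _ => funext fun _ => by
        rw [globalSymGradRec_smul]
        exact frob_smul_right _ _ _))
    fun u v => (isStrain_globalSymGradRec u).integrable_frob (isStrain_globalSymGradRec v)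

theorem strainForm_apply (u v : Dofs 𝓜 k) : strainForm 𝓜 k u v =
    ∫ x in Ω, frob (globalSymGradRec u x) (globalSymGradRec v x) := rfl

theorem globalSymGradRec_sub (u v : Dofs 𝓜 k) :
    globalSymGradRec (u - v) = globalSymGradRec u - globalSymGradRec v := by
  rw [sub_eq_add_neg, ← neg_one_smul ℝ v, globalSymGradRec_add, globalSymGradRec_smul,
    neg_one_smul, ← sub_eq_add_neg]

/-- The monotonicity defect of the consistency contribution as an integral. -/
theorem consistencyLin_sub_apply_sub (hσ : StressAssumption Ω σ) (u v : Dofs 𝓜 k) :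
    consistencyLin hσ u (u - v) - consistencyLin hσ v (u - v) =
      ∫ x in Ω, frob (σ x (globalSymGradRec u x) - σ x (globalSymGradRec v x))
        (globalSymGradRec u x - globalSymGradRec v x) := by
  rw [consistencyLin_apply, consistencyLin_apply, consistency, consistency, ← integral_sub
    (hσ.integrable_frob (isStrain_globalSymGradRec u) (isStrain_globalSymGradRec _))
    (hσ.integrable_frob (isStrain_globalSymGradRec v) (isStrain_globalSymGradRec _))]
  refine integral_congr_ae (Eventually.of_forall fun x => ?_)
  simp only
  rw [globalSymGradRec_sub, frob_sub_left]
  rfl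

theorem ae_monotone (hσ : StressAssumption Ω σ) (u v : Dofs 𝓜 k) :
    ∀ᵐ x ∂(volume.restrict Ω), 0 ≤ frob (σ x (globalSymGradRec u x) - σ x (globalSymGradRec v x))
      (globalSymGradRec u x - globalSymGradRec v x) := by
  obtain ⟨_, _, _, _, hb⟩ := hσ.bounds
  filter_upwards [hb] with x hx
  exact (hx _ ((isStrain_globalSymGradRec (Ω := Ω) u).symm x) _
    ((isStrain_globalSymGradRec (Ω := Ω) v).symm x)).2.2

theorem consistencyLin_monotone (hσ : StressAssumption Ω σ) (u v : Dofs 𝓜 k) :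
    0 ≤ consistencyLin hσ u (u - v) - consistencyLin hσ v (u - v) := by
  rw [consistencyLin_sub_apply_sub]
  exact integral_nonneg_of_ae (ae_monotone hσ u v)

/-- Both terms are nonnegative, so each is zero and the qualitative Korn inequality applies. The
hypothesis `≤ 0` is the negation of the positivity needed for Minty's theorem. -/
theorem eq_zero_of_strainForm_add_stab (hΩ : IsDomain Ω) (hd : 2 ≤ d) (hk : 1 ≤ k) {γ : ℝ}
    (hγ : 0 < γ) {v : Dofs 𝓜 k} (hv : v ∈ Dofs0 𝓜 k)
    (h : strainForm 𝓜 k v v + stab γ v v ≤ 0) : v = 0 := by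
  have h1 : 0 ≤ strainForm 𝓜 k v v := integral_nonneg fun x => frob_self_nonneg _
  have h2 := stab_self_nonneg hγ v
  have h3 : strainForm 𝓜 k v v = 0 := by linarith
  refine eq_zero_of_symGradRec_of_stab hd hk hγ hv
    (symGradRecLin_eq_zero_of_ae hΩ.isOpenPolyhedron.interior_closure ?_) (by linarith)
  have hs := isStrain_globalSymGradRec (Ω := Ω) v
  exact ((integral_eq_zero_iff_of_nonneg (fun x => frob_self_nonneg _)
    (hs.integrable_frob hs)).1 h3).mono fun x hx => frob_self_eq_zero hx

set_option maxHeartbeats 1000000 in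
theorem exists_isDiscreteSolution (hΩ : IsDomain Ω) (hd : 2 ≤ d) (hk : 1 ≤ k) {γ : ℝ} (hγ : 0 < γ)
    (hσ : StressAssumption Ω σ) {f : E d → E d} (hf : MemLp f 2 (volume.restrict Ω)) :
    ∃ u : Dofs 𝓜 k, IsDiscreteSolution σ γ f u := by
  let ι := (Dofs0 𝓜 k).subtype
  let B : Dofs0 𝓜 k →ₗ[ℝ] Dofs0 𝓜 k →ₗ[ℝ] ℝ := (strainForm 𝓜 k + stabForm γ).compl₁₂ ι ι
  have hB : ∀ u v : Dofs0 𝓜 k, B u v = strainForm 𝓜 k u.1 v.1 + stab γ u.1 v.1 := fun u v => by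
    rw [← stabForm_apply]
    rfl
  let a : Dofs0 𝓜 k → Dofs0 𝓜 k →ₗ[ℝ] ℝ := fun u =>
    (consistencyLin hσ u.1 + stabForm γ u.1) ∘ₗ ι
  have ha : ∀ u v : Dofs0 𝓜 k, a u v = consistencyLin hσ u.1 v.1 + stabForm γ u.1 v.1 :=
    fun u v => rfl
  obtain ⟨s, _, c, hc, hb⟩ := hσ.bounds
  -- `c` is the lower bound in the stress assumption and controls the strain part; the stabilisation
  -- occurs in both sides with factor 1, hence the minimum.
  have hcoer : ∀ u : Dofs0 𝓜 k, min c 1 * B u u ≤ a u u := by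
    intro u
    have h1 : c * strainForm 𝓜 k u.1 u.1 ≤ consistencyLin hσ u.1 u.1 := by
      have hs := isStrain_globalSymGradRec (Ω := Ω) u.1
      rw [strainForm_apply, consistencyLin_apply, consistency, ← integral_const_mul]
      refine integral_mono_ae ((hs.integrable_frob hs).const_mul c) (hσ.integrable_frob hs hs) ?_
      filter_upwards [hb] with x hx
      rw [← frobNorm_sq]
      exact (hx _ (hs.symm x) 0 Matrix.isSymm_zero).2.1
    have h2 : 0 ≤ strainForm 𝓜 k u.1 u.1 := integral_nonneg fun x => frob_self_nonneg _
    have h3 := stab_self_nonneg hγ u.1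
    have h4 : min c 1 * strainForm 𝓜 k u.1 u.1 ≤ c * strainForm 𝓜 k u.1 u.1 :=
      mul_le_mul_of_nonneg_right (min_le_left _ _) h2
    have h5 : min c 1 * stab γ u.1 u.1 ≤ 1 * stab γ u.1 u.1 :=
      mul_le_mul_of_nonneg_right (min_le_right _ _) h3
    rw [hB, ha, stabForm_apply, mul_add]
    linarith
  have hsymm : ∀ u v, B u v = B v u := fun u v => by
    rw [hB, hB, stab_comm, strainForm_apply, strainForm_apply]
    simp only [frob_comm]
  have hpos : ∀ u, u ≠ 0 → 0 < B u u := fun u hu => by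
    rw [hB]
    by_contra! h
    exact hu (Subtype.ext (eq_zero_of_strainForm_add_stab hΩ hd hk hγ u.2 h))
  have hmono : ∀ u v, 0 ≤ (a u - a v) (u - v) := fun u v => by
    have h1 := consistencyLin_monotone hσ u.1 v.1
    have h2 := stab_self_nonneg hγ (u.1 - v.1)
    rw [← stabForm_apply, LinearMap.map_sub₂] at h2
    rw [LinearMap.sub_apply, ha, ha]
    simp only [Submodule.coe_sub]
    linarith
  -- The stress part is dominated convergence, and the stabilisation is affine in `t`.
  have hcont : ∀ u w v, Tendsto (fun t : ℝ => a (u + t • w) v) (𝓝[>] 0) (𝓝 (a u v)) :=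
    fun u w v => by
    have h1 := hσ.tendsto_integral (isStrain_globalSymGradRec (Ω := Ω) u.1)
      (isStrain_globalSymGradRec w.1) (isStrain_globalSymGradRec v.1)
    have h2 : Tendsto (fun t : ℝ => stabForm γ u.1 v.1 + t * stabForm γ w.1 v.1) (𝓝[>] 0)
        (𝓝 (stabForm γ u.1 v.1)) := by
      have : Continuous fun t : ℝ => stabForm γ u.1 v.1 + t * stabForm γ w.1 v.1 := by fun_prop
      simpa using (this.tendsto 0).mono_left (nhdsWithin_le_nhds (s := Ioi 0))
    rw [ha]
    refine (h1.add h2).congr fun t => ?_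
    rw [ha, consistencyLin_apply, consistency]
    simp only [Submodule.coe_add, Submodule.coe_smul, globalSymGradRec_add,
      globalSymGradRec_smul, map_add, map_smul, LinearMap.add_apply, LinearMap.smul_apply,
      smul_eq_mul]
  obtain ⟨u, hu⟩ := exists_forall_eq_of_monotone_of_posDef (V := Dofs0 𝓜 k) B hsymm hpos a hmono
    hcont (lt_min hc one_pos) hcoer (loadLin 𝓜 k hf ∘ₗ ι)
  refine ⟨u.1, u.2, fun v hv => ?_⟩
  have h := hu ⟨v, hv⟩
  rw [ha, stabForm_apply] at h
  exact h

/-- Subtracting the equations and testing with u - v leaves a sum of two nonnegative terms equal to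
zero. Strict monotonicity gives equal strains almost everywhere, the stabilisation of u - v
vanishes, and definiteness on U_{h,0} concludes. -/
theorem IsDiscreteSolution.unique (hΩ : IsDomain Ω) (hd : 2 ≤ d) (hk : 1 ≤ k) {γ : ℝ} (hγ : 0 < γ)
    (hσ : StressAssumption Ω σ) (hstrict : StrictlyMonotoneStress Ω σ) {f : E d → E d}
    {u v : Dofs 𝓜 k} (hu : IsDiscreteSolution σ γ f u) (hv : IsDiscreteSolution σ γ f v) :
    u = v := by
  have hw : u - v ∈ Dofs0 𝓜 k := (Dofs0 𝓜 k).sub_mem hu.1 hv.1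
  have h1 : consistencyLin hσ u (u - v) + stabForm γ u (u - v)
      = consistencyLin hσ v (u - v) + stabForm γ v (u - v) := by
    rw [consistencyLin_apply, consistencyLin_apply, stabForm_apply, stabForm_apply]
    exact (hu.2 _ hw).trans (hv.2 _ hw).symm
  have h2 := consistencyLin_monotone hσ u v
  have h3 := stab_self_nonneg hγ (u - v)
  have h4 : stab γ (u - v) (u - v) = stabForm γ u (u - v) - stabForm γ v (u - v) := by
    rw [← stabForm_apply, LinearMap.map_sub₂]
  have h5 : consistencyLin hσ u (u - v) - consistencyLin hσ v (u - v) = 0 := by linarith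
  have h6 : stab γ (u - v) (u - v) = 0 := by linarith
  rw [consistencyLin_sub_apply_sub] at h5
  have hint : Integrable (fun x => frob (σ x (globalSymGradRec u x) - σ x (globalSymGradRec v x))
      (globalSymGradRec u x - globalSymGradRec v x)) (volume.restrict Ω) :=
    hσ.integrable_frob_sub (isStrain_globalSymGradRec u) (isStrain_globalSymGradRec v)
  have h7 := (integral_eq_zero_iff_of_nonneg_ae (ae_monotone hσ u v) hint).1 h5
  refine sub_eq_zero.1 (eq_zero_of_symGradRec_of_stab hd hk hγ hw
    (symGradRecLin_eq_zero_of_ae hΩ.isOpenPolyhedron.interior_closure ?_) h6)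
  filter_upwards [h7, hstrict] with x hx hsx
  rw [globalSymGradRec_sub, Pi.sub_apply, sub_eq_zero]
  by_contra hne
  exact (hsx _ ((isStrain_globalSymGradRec (Ω := Ω) u).symm x) _
    ((isStrain_globalSymGradRec (Ω := Ω) v).symm x) hne).ne' hx

end

end HHO

end

theorem theorem1 {d : ℕ} (hd : d = 2 ∨ d = 3) {Ω : Set (HHO.E d)} (hΩ : HHO.IsDomain Ω)
    (f : HHO.E d → HHO.E d) (hf : MemLp f 2 (volume.restrict Ω))
    (σ : HHO.E d → HHO.Mat d → HHO.Mat d) (hσ : HHO.StressAssumption Ω σ)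
    (γ : ℝ) (hγ : 0 < γ) (k : ℕ) (hk : 1 ≤ k)
    (H : Set ℝ) (𝓣 : H → HHO.PolytopalMesh Ω) (h𝓣 : HHO.IsRegularMeshSequence H 𝓣) (h : H) :
    (∃ u : HHO.Dofs (𝓣 h) k, HHO.IsDiscreteSolution σ γ f u) ∧
    (HHO.StrictlyMonotoneStress Ω σ →
      ∃! u : HHO.Dofs (𝓣 h) k, HHO.IsDiscreteSolution σ γ f u) := by
  have hd2 : 2 ≤ d := by omega
  obtain ⟨u, hu⟩ := HHO.exists_isDiscreteSolution (𝓜 := 𝓣 h) hΩ hd2 hk hγ hσ hf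
  exact ⟨⟨u, hu⟩, fun hstrict => ⟨u, hu, fun v hv =>
    HHO.IsDiscreteSolution.unique hΩ hd2 hk hγ hσ hstrict hv hu⟩⟩
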